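/- Let $n\ge 3$ and let $M$ be a smooth connected $n$-dimensional manifold with compact, nonempty smooth boundary $\Sigma=\partial M$. Let $g$ be a Riemannian metric on $M$, smooth up to the boundary, that is asymptotically flat with one end: there are a compact set $K\subset M$ and a diffeomorphism $\Phi:M\setminus K\to\mathbb{R}^n\setminus\overline B$ ($\overline B$ a closed ball) in whose coordinates, for $|x|$ large and all $i,j,k,l$, $$|g_{ij}-\delta_{ij}|\le \frac{c}{|x|^{p}},\quad |\partial_k g_{ij}|\le \frac{c}{|x|^{p+1}},\quad |\partial_k\partial_l g_{ij}|\le \frac{c}{|x|^{p+2}},\quad |R|\le \frac{c}{|x|^{q}},$$ where $c>0$, $p>\frac{n-2}{2}$, $q>n$ are constants and $R$ is the scalar curvature of $g$. Let $\overline g$ belong to the harmonic conformal class of $g$, that is, $\overline g=u^{\frac{4}{n-2}}g$ for some $u>0$ that is smooth on $M$ (up to the boundary), satisfies $\Delta_g u=0$, and tends to $1$ at infinity. Let $\varphi$ and $\overline\varphi$ be the functions on $M$, smooth up to the boundary and harmonic with respect to $g$ and $\overline g$ respectively, that vanish on $\Sigma$ and tend to $1$ at infinity. Let $\nu,\overline\nu$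 be the unit normals to $\Sigma$ pointing into $M$, and $dA,\overline{dA}$ the hypersurface measures on $\Sigma$, with respect to $g$ and $\overline g$ respectively. Let $\omega_{n-1}$ be the area of the unit sphere in $\mathbb{R}^n$, and put $$I_2(g)=\frac{2}{(n-2)^2}\left(\frac{1}{\omega_{n-1}}\int_\Sigma(\partial_\nu\varphi)^{\frac{2(n-1)}{n}}\,dA\right)^{\frac{n}{n-1}},\qquad I_2(\overline g)=\frac{2}{(n-2)^2}\left(\frac{1}{\omega_{n-1}}\int_\Sigma(\partial_{\overline\nu}\overline\varphi)^{\frac{2(n-1)}{n}}\,\overline{dA}\right)^{\frac{n}{n-1}}.$$ Then $(\partial_\nu\varphi)^{\frac{2(n-1)}{n}}$ and $(\partial_{\overline\nu}\overline\varphi)^{\frac{2(n-1)}{n}}$ are integrable over $\Sigma$ with respect to $dA$ and $\overline{dA}$ respectively, $$(\partial_{\overline\nu}\overline\varphi)^{\frac{2(n-1)}{n}}\,\overline{dA}=(\partial_\nu\varphi)^{\frac{2(n-1)}{n}}\,dA\quad\text{as measures on }\Sigma,$$ and consequently $$\int_\Sigma(\partial_{\overline\nu}\overline\varphi)^{\frac{2(n-1)}{n}}\,\overline{dA}=\int_\Sigma(\partial_\nu\varphi)^{\frac{2(n-1)}{n}}\,dA\qquad\text{and}\qquad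 I_2(\overline g)=I_2(g).$$ -/

import Mathlib

open MeasureTheory Filter
open scoped Manifold ContDiff Topology

noncomputable section

/-- Smooth Riemannian metrics (smooth up to the boundary) on an `n`-manifold with boundary `M`. -/
abbrev SmoothMetric (n : ℕ) [NeZero n] (M : Type*) [TopologicalSpace M]
    [ChartedSpace (EuclideanHalfSpace n) M] [IsManifold (𝓡∂ n) ∞ M] :=
  Bundle.ContMDiffRiemannianMetric (𝓡∂ n) ∞ (EuclideanSpace ℝ (Fin n))
    (fun p : M => TangentSpace (𝓡∂ n) p)

/-! ### Tensor calculus in coordinates on (subsets of) Euclidean space -/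

section Coordinates

variable {n : ℕ}

/-- The partial derivative `∂_i f (x)`, computed within the set `S`. -/
def pderivWithin (S : Set (EuclideanSpace ℝ (Fin n))) (i : Fin n)
    (f : EuclideanSpace ℝ (Fin n) → ℝ) (x : EuclideanSpace ℝ (Fin n)) : ℝ :=
  fderivWithin ℝ f S x (EuclideanSpace.single i 1)

/-- The partial derivative `∂_i f (x)`. -/
def pderiv (i : Fin n) (f : EuclideanSpace ℝ (Fin n) → ℝ) (x : EuclideanSpace ℝ (Fin n)) : ℝ :=
  fderiv ℝ f x (EuclideanSpace.single i 1)

/-- The Laplace-Beltrami operator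
`Δ f = (det G)^(-1/2) ∑ i j, ∂_i ((det G)^(1/2) G^{ij} ∂_j f)`
of the metric with coefficient matrix `G`, at the point `x`; derivatives are taken within `S`. -/
def coordLaplacian (S : Set (EuclideanSpace ℝ (Fin n)))
    (G : EuclideanSpace ℝ (Fin n) → Matrix (Fin n) (Fin n) ℝ)
    (f : EuclideanSpace ℝ (Fin n) → ℝ) (x : EuclideanSpace ℝ (Fin n)) : ℝ :=
  (Real.sqrt (G x).det)⁻¹ * ∑ i, ∑ j,
    pderivWithin S i
      (fun y => Real.sqrt (G y).det * (G y)⁻¹ i j * pderivWithin S j f y) x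

/-- The Christoffel symbol `Γ^k_{ij}` of the metric with coefficient matrix `G`. -/
def christoffel (G : EuclideanSpace ℝ (Fin n) → Matrix (Fin n) (Fin n) ℝ)
    (k i j : Fin n) (x : EuclideanSpace ℝ (Fin n)) : ℝ :=
  (1 / 2) * ∑ l, (G x)⁻¹ k l *
    (pderiv i (fun y => G y j l) x + pderiv j (fun y => G y i l) x
      - pderiv l (fun y => G y i j) x)

/-- The Ricci curvature `R_{ij}` of the metric with coefficient matrix `G`. -/
def coordRicci (G : EuclideanSpace ℝ (Fin n) → Matrix (Fin n) (Fin n) ℝ)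
    (i j : Fin n) (x : EuclideanSpace ℝ (Fin n)) : ℝ :=
  ∑ k, (pderiv k (christoffel G k i j) x - pderiv j (christoffel G k i k) x
    + ∑ l, (christoffel G k k l x * christoffel G l i j x
      - christoffel G k j l x * christoffel G l i k x))

/-- The scalar curvature `R = G^{ij} R_{ij}` of the metric with coefficient matrix `G`. -/
def coordScalarCurvature (G : EuclideanSpace ℝ (Fin n) → Matrix (Fin n) (Fin n) ℝ)
    (x : EuclideanSpace ℝ (Fin n)) : ℝ :=
  ∑ i, ∑ j, (G x)⁻¹ i j * coordRicci G i j x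

end Coordinates

section Manifold

variable {n : ℕ} [NeZero n] {M : Type*} [TopologicalSpace M]
  [ChartedSpace (EuclideanHalfSpace n) M] [IsManifold (𝓡∂ n) ∞ M]

/-- The coefficients `g_{ij}(x) = g (∂_i ψ, ∂_j ψ)` of the metric `g` in the parametrization
`ψ` of a piece of `M`; the derivative of `ψ` is taken within `S`. -/
def metricCoeff (g : SmoothMetric n M) (S : Set (EuclideanSpace ℝ (Fin n)))
    (ψ : EuclideanSpace ℝ (Fin n) → M) (x : EuclideanSpace ℝ (Fin n)) :
    Matrix (Fin n) (Fin n) ℝ :=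
  Matrix.of fun i j =>
    g.inner (ψ x)
      (mfderivWithin 𝓘(ℝ, EuclideanSpace ℝ (Fin n)) (𝓡∂ n) ψ S x (EuclideanSpace.single i (1 : ℝ)))
      (mfderivWithin 𝓘(ℝ, EuclideanSpace ℝ (Fin n)) (𝓡∂ n) ψ S x (EuclideanSpace.single j (1 : ℝ)))

/-- The coefficients `g_{ij}` of `g` in a chart `e` of the manifold with boundary `M`. -/
def chartMetricCoeff (g : SmoothMetric n M) (e : OpenPartialHomeomorph M (EuclideanHalfSpace n)) :
    EuclideanSpace ℝ (Fin n) → Matrix (Fin n) (Fin n) ℝ :=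
  metricCoeff g (Set.range (𝓡∂ n)) (e.extend (𝓡∂ n)).symm

/-- `(M, g)` is asymptotically flat with one end: outside a compact set `K` there are global
coordinates `Φ : M \ K → ℝⁿ \ (closed ball)`, a diffeomorphism, in which `g` decays to the
Euclidean metric. -/
def IsAsymptoticallyFlat (g : SmoothMetric n M) : Prop :=
  ∃ (K : Set M) (Φ : OpenPartialHomeomorph M (EuclideanSpace ℝ (Fin n)))
    (a : EuclideanSpace ℝ (Fin n)) (ρ : ℝ),
    IsCompact K ∧ 0 < ρ ∧ Φ.source = Kᶜ ∧ Φ.target = (Metric.closedBall a ρ)ᶜ ∧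
    ContMDiffOn (𝓡∂ n) 𝓘(ℝ, EuclideanSpace ℝ (Fin n)) ∞ Φ Φ.source ∧
    ContMDiffOn 𝓘(ℝ, EuclideanSpace ℝ (Fin n)) (𝓡∂ n) ∞ Φ.symm Φ.target ∧
    ∃ (c p q r : ℝ), 0 < c ∧ ((n : ℝ) - 2) / 2 < p ∧ (n : ℝ) < q ∧
      ∀ x ∈ Φ.target, r ≤ ‖x‖ →
        (∀ i j, |metricCoeff g Set.univ Φ.symm x i j - (1 : Matrix (Fin n) (Fin n) ℝ) i j|
          ≤ c / ‖x‖ ^ p) ∧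
        (∀ i j k, |pderiv k (fun y => metricCoeff g Set.univ Φ.symm y i j) x|
          ≤ c / ‖x‖ ^ (p + 1)) ∧
        (∀ i j k l, |pderiv k (pderiv l (fun y => metricCoeff g Set.univ Φ.symm y i j)) x|
          ≤ c / ‖x‖ ^ (p + 2)) ∧
        |coordScalarCurvature (metricCoeff g Set.univ Φ.symm) x| ≤ c / ‖x‖ ^ q

/-- `f` is a smooth (up to the boundary) function on `M` with `Δ_g f = 0`. The equation is
written in every smooth chart; boundary charts use one-sided derivatives. -/
def IsHarmonic (g : SmoothMetric n M) (f : M → ℝ) : Prop :=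
  ContMDiff (𝓡∂ n) 𝓘(ℝ, ℝ) ∞ f ∧
  ∀ e ∈ IsManifold.maximalAtlas (𝓡∂ n) ∞ M, ∀ x ∈ (e.extend (𝓡∂ n)).target,
    coordLaplacian (Set.range (𝓡∂ n)) (chartMetricCoeff g e)
      (f ∘ (e.extend (𝓡∂ n)).symm) x = 0

/-- `f → c` at infinity in `M`, that is, along the complements of the compact subsets of `M`. -/
def TendsToAtInfinity (f : M → ℝ) (c : ℝ) : Prop :=
  Tendsto f (cocompact M) (𝓝 c)

/-- The harmonic conformal class of `g`: all metrics `u ^ (4 / (n - 2)) g`, where `u > 0` is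
smooth and `g`-harmonic on `M` and tends to `1` at infinity. -/
def harmonicConformalClass (g : SmoothMetric n M) : Set (SmoothMetric n M) :=
  {g' | ∃ u : M → ℝ, (∀ p, 0 < u p) ∧ IsHarmonic g u ∧ TendsToAtInfinity u 1 ∧
    ∀ (p : M) (v w : TangentSpace (𝓡∂ n) p),
      g'.inner p v w = u p ^ (4 / ((n : ℝ) - 2)) * g.inner p v w}

/-- `φ` is the `g`-harmonic function that vanishes on the boundary and tends to `1` at infinity. -/
structure IsBoundaryPotential (g : SmoothMetric n M) (φ : M → ℝ) : Prop where
  harmonic : IsHarmonic g φ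
  eq_zero : ∀ p ∈ (𝓡∂ n).boundary M, φ p = 0
  tendsto : TendsToAtInfinity φ 1

/-! ### The inward unit normal -/

/-- The differential `dx⁰` at `p` of the first coordinate of the preferred chart at `p`.
At a boundary point this coordinate is a boundary defining function: it vanishes on the boundary
and is positive inside. So `v` is tangent to the boundary iff `dx⁰(v) = 0`, and points into the
manifold iff `dx⁰(v) > 0`. -/
def normalCovector (p : M) : TangentSpace (𝓡∂ n) p →ₗ[ℝ] ℝ :=
  (EuclideanSpace.proj (𝕜 := ℝ) (0 : Fin n)).toLinearMap ∘ₗ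
    (mfderiv (𝓡∂ n) 𝓘(ℝ, EuclideanSpace ℝ (Fin n)) (extChartAt (𝓡∂ n) p) p).toLinearMap

/-- `ν` is a `g`-unit vector at the boundary point `p`, orthogonal to all vectors tangent to the
boundary, and pointing into the manifold. -/
structure IsInwardUnitNormal (g : SmoothMetric n M) (p : M) (ν : TangentSpace (𝓡∂ n) p) :
    Prop where
  unit : g.inner p ν ν = 1
  orthogonal : ∀ w : TangentSpace (𝓡∂ n) p, normalCovector p w = 0 → g.inner p ν w = 0
  inward : 0 < normalCovector p ν

theorem exists_isInwardUnitNormal (g : SmoothMetric n M) (p : M) :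
    ∃ ν, IsInwardUnitNormal g p ν := by
  let L : TangentSpace (𝓡∂ n) p →ₗ[ℝ] ℝ := normalCovector p
  have hL : ∃ v, L v ≠ 0 := by
    refine ⟨(EuclideanSpace.single (0 : Fin n) (1 : ℝ) : EuclideanSpace ℝ (Fin n)), ?_⟩
    change normalCovector p _ ≠ 0
    simp only [normalCovector, mfderiv_extChartAt_self]
    change (EuclideanSpace.single (0 : Fin n) (1 : ℝ) : EuclideanSpace ℝ (Fin n)) 0 ≠ 0
    simp
  let B : TangentSpace (𝓡∂ n) p →ₗ[ℝ] (TangentSpace (𝓡∂ n) p →ₗ[ℝ] ℝ) :=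
    { toFun := fun v => (g.inner p v).toLinearMap
      map_add' := fun v w => by ext; simp
      map_smul' := fun c v => by ext; simp }
  have hB : Function.Injective B := by
    rw [injective_iff_map_eq_zero]
    intro v hv
    by_contra h
    have h1 := g.pos p v h
    have h2 : g.inner p v v = 0 := congrArg (fun f => f v) hv
    linarith
  have : FiniteDimensional ℝ (TangentSpace (𝓡∂ n) p) :=
    inferInstanceAs (FiniteDimensional ℝ (EuclideanSpace ℝ (Fin n)))
  obtain ⟨z, hz⟩ := (LinearMap.injective_iff_surjective_of_finrank_eq_finrank
    (Subspace.dual_finrank_eq (K := ℝ) (V := TangentSpace (𝓡∂ n) p)).symm).1 hB L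
  have hzw : ∀ w, g.inner p z w = normalCovector p w := fun w => congrArg (fun f => f w) hz
  have hz0 : z ≠ 0 := by
    rintro rfl
    obtain ⟨v, hv⟩ := hL
    apply hv
    change normalCovector p v = 0
    rw [← hzw v]
    simp
  have hpos := g.pos p z hz0
  set N := Real.sqrt (g.inner p z z) with hN
  have hNpos : 0 < N := Real.sqrt_pos.2 hpos
  have hNN : N * N = g.inner p z z := Real.mul_self_sqrt hpos.le
  refine ⟨N⁻¹ • z, ?_, ?_, ?_⟩
  · simp only [map_smul, FunLike.coe_smul, Pi.smul_apply, smul_eq_mul, ← hNN]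
    field_simp
  · intro w hw
    simp only [map_smul, FunLike.coe_smul, Pi.smul_apply, hzw w, hw, smul_zero]
  · have : normalCovector p (N⁻¹ • z) = N⁻¹ * normalCovector p z := L.map_smul N⁻¹ z
    rw [this, ← hzw z]
    positivity

/-- The inward unit normal at a point is unique. -/
theorem IsInwardUnitNormal.unique {g : SmoothMetric n M} {p : M}
    {v w : TangentSpace (𝓡∂ n) p} (hv : IsInwardUnitNormal g p v)
    (hw : IsInwardUnitNormal g p w) : v = w := by
  set a := normalCovector p w with ha
  set b := normalCovector p v with hb
  have ha0 : 0 < a := hw.inward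
  have hb0 : 0 < b := hv.inward
  have ht : normalCovector p (a • v - b • w) = 0 := by
    rw [map_sub, map_smul, map_smul, smul_eq_mul, smul_eq_mul, ← ha, ← hb]
    ring
  have h1 := hv.orthogonal _ ht
  have h2 := hw.orthogonal _ ht
  simp only [map_sub, map_smul, smul_eq_mul, hv.unit, hw.unit] at h1 h2
  rw [g.symm p w v] at h2
  have hab : a = b := by
    have h3 : (a - b) * (a + b) = 0 := by linear_combination a * h1 + b * h2
    rcases mul_eq_zero.1 h3 with h | h <;> linarith
  have hvw : g.inner p v w = 1 := by
    rw [hab] at h1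
    have : b * (1 - g.inner p v w) = 0 := by linear_combination h1
    rcases mul_eq_zero.1 this with h | h <;> linarith
  by_contra hne
  have h4 := g.pos p (v - w) (sub_ne_zero.2 hne)
  have h5 : g.inner p (v - w) (v - w) = 0 := by
    simp only [map_sub, FunLike.coe_sub, Pi.sub_apply, hv.unit, hw.unit, g.symm p w v, hvw]
    ring
  linarith

/-- The unit normal `ν` to the boundary with respect to `g`, pointing into the manifold (only
used at boundary points). -/
def inwardUnitNormal (g : SmoothMetric n M) (p : M) : TangentSpace (𝓡∂ n) p :=
  Classical.choose (exists_isInwardUnitNormal g p)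

/-- The normal derivative `∂_ν φ` at a boundary point `p`. -/
def normalDeriv (g : SmoothMetric n M) (φ : M → ℝ) (p : M) : ℝ :=
  mfderiv (𝓡∂ n) 𝓘(ℝ, ℝ) φ p (inwardUnitNormal g p)

/-! ### The hypersurface measure of the boundary -/

/-- The inclusion `y ↦ (0, y)` of `ℝⁿ⁻¹` as the boundary hyperplane of the half-space. -/
def boundaryIncl (y : {i : Fin n // i ≠ 0} → ℝ) : EuclideanSpace ℝ (Fin n) :=
  WithLp.toLp 2 fun i => if h : i ≠ 0 then y ⟨i, h⟩ else 0

/-- The hypersurface measure of `∂M` inside the domain of the chart `e`, as a measure on `M`: the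
image of `√(det (g_{ij})_{i,j ≠ 0}) dy` under the parametrization `y ↦ e⁻¹(0, y)`. -/
def chartBoundaryMeasure [MeasurableSpace M] (g : SmoothMetric n M)
    (e : OpenPartialHomeomorph M (EuclideanHalfSpace n)) : Measure M :=
  (((volume : Measure ({i : Fin n // i ≠ 0} → ℝ)).restrict
      (boundaryIncl ⁻¹' (e.extend (𝓡∂ n)).target)).withDensity
    (fun y => ENNReal.ofReal (Real.sqrt
      ((chartMetricCoeff g e (boundaryIncl y)).submatrix
        (Subtype.val : {i : Fin n // i ≠ 0} → Fin n) Subtype.val).det))).map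
    (fun y => (e.extend (𝓡∂ n)).symm (boundaryIncl y))

/-- The hypersurface measure `dA` induced by `g` on the boundary, as a Borel measure on `M` carried
by `∂M`. Its restriction to the domain of any smooth chart is the measure of that chart; it is the
least measure dominating all of these. -/
def boundaryMeasure [MeasurableSpace M] (g : SmoothMetric n M) : Measure M :=
  ⨆ e ∈ IsManifold.maximalAtlas (𝓡∂ n) ∞ M, chartBoundaryMeasure g e

/-! ### The invariant -/

/-- The area `ω_{n-1}` of the unit sphere of `ℝⁿ`. -/
def unitSphereArea (n : ℕ) : ℝ :=
  ((volume : Measure (EuclideanSpace ℝ (Fin n))).toSphere).real Set.univ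

/-- The function `(∂_ν φ) ^ (2 (n - 1) / n)` on the boundary. -/
def fluxDensity (g : SmoothMetric n M) (φ : M → ℝ) (p : M) : ℝ :=
  normalDeriv g φ p ^ (2 * ((n : ℝ) - 1) / n)

/-- The number
`I₂ = 2 / (n-2)² * ((1 / ω_{n-1}) ∫_{∂M} (∂_ν φ) ^ (2(n-1)/n) dA) ^ (n / (n-1))`. -/
def invariantI2 [MeasurableSpace M] (g : SmoothMetric n M) (φ : M → ℝ) : ℝ :=
  2 / ((n : ℝ) - 2) ^ 2 *
    (1 / unitSphereArea n *
      ∫ p in (𝓡∂ n).boundary M, fluxDensity g φ p ∂(boundaryMeasure g)) ^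
      ((n : ℝ) / ((n : ℝ) - 1))

end Manifold

end

/-! Write `g' = u ^ (4 / (n - 2)) g` and let `A = √(det G) G⁻¹` be the coefficient matrix of the
Laplacian in divergence form. The exponent is the one for which `A` becomes `u² A`
(`laplaceCoeff_conformal`), and `div (u² A ∇f) = u div (A ∇(u f)) - u f div (A ∇u)`
(`divergenceOp_sq_mul`). Since `u` is `g`-harmonic, `u φ'` is `g`-harmonic too. It has the boundary
values and the limit of `φ`, so uniqueness gives `φ = u φ'` (`IsBoundaryPotential.eq_mul`).

On the boundary `φ'` vanishes, so `∂_ν φ = u ∂_ν φ'`. The unit normal scales by `u ^ (-2 / (n - 2))`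
and the area by `u ^ (2 (n - 1) / (n - 2))`. After raising the normal derivative to the power `2 (n
- 1) / n` all powers of `u` cancel (`rpow_flux_mul_density`), which is the equality of measures; the
integrals and `I₂` follow.

Uniqueness is a comparison principle (`IsInteriorHarmonic.le_of_le_boundary`). A positive value of
the difference would force a positive maximum, because the limit at infinity is at most zero. By
Hopf's strong maximum principle the set of maximum points is open, hence all of the connected `M`,
against the sign on the boundary. Comparison with `0` also gives `φ ≥ 0`, so the normal derivatives
are nonnegative and the real powers obey the usual rules.

Integrability needs a continuous integrand and a finite measure. Continuity comes from `∂_ν φ =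
|dφ|` on the boundary, where the right side is explicit in charts. Finiteness needs control of a
supremum over all charts: by the change of variables formula no chart gives a set more mass than a
chart containing the set, and finitely many charts cover the compact boundary. -/

set_option linter.unusedSectionVars false

noncomputable section

/-! ### Second order operators at a maximum, and the Hopf barrier -/

section EuclideanMaximumPrinciple

variable {n : ℕ}

/-- The elliptic operator `∑ a_ij ∂_i ∂_j f + ∑ b_j ∂_j f`. -/
def ellipticOp (a : EuclideanSpace ℝ (Fin n) → Matrix (Fin n) (Fin n) ℝ)
    (b : EuclideanSpace ℝ (Fin n) → Fin n → ℝ) (f : EuclideanSpace ℝ (Fin n) → ℝ)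
    (x : EuclideanSpace ℝ (Fin n)) : ℝ :=
  (∑ i, ∑ j, a x i j * pderiv i (pderiv j f) x) + ∑ j, b x j * pderiv j f x

/-- Restrict to the line through `x` in direction `v`. A positive second derivative would make `x` a
local minimum as well as a local maximum of the restriction, which would then be locally constant
with vanishing second derivative. -/
theorem fderiv_fderiv_apply_nonpos_of_isLocalMax {E : Type*} [NormedAddCommGroup E]
    [NormedSpace ℝ E] {f : E → ℝ} {x : E} (hf : ContDiffAt ℝ 2 f x) (hmax : IsLocalMax f x)
    (v : E) : fderiv ℝ (fderiv ℝ f) x v v ≤ 0 := by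
  by_contra! hpos
  have hγ : ∀ t : ℝ, HasDerivAt (fun t : ℝ => x + t • v) v t := fun t => by
    simpa using ((hasDerivAt_id t).smul_const v).const_add x
  have hγc : ContinuousAt (fun t : ℝ => x + t • v) 0 := (hγ 0).continuousAt
  have hx0 : x + (0 : ℝ) • v = x := by simp
  have hev : ∀ᶠ y in 𝓝 x, DifferentiableAt ℝ f y := by
    filter_upwards [hf.eventually (by simp)] with y hy
    exact hy.differentiableAt (by norm_num)
  have hd : (deriv fun t : ℝ => f (x + t • v)) =ᶠ[𝓝 0] fun t => fderiv ℝ f (x + t • v) v := by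
    have := hγc.tendsto
    rw [hx0] at this
    filter_upwards [this.eventually hev] with t ht
    exact (ht.hasFDerivAt.comp_hasDerivAt t (hγ t)).deriv
  have hf' : DifferentiableAt ℝ (fderiv ℝ f) x :=
    (hf.fderiv_right (m := 1) (by norm_num)).differentiableAt (by norm_num)
  have hdd : deriv (deriv fun t : ℝ => f (x + t • v)) 0 = fderiv ℝ (fderiv ℝ f) x v v := by
    rw [hd.deriv_eq]
    have h1 : HasFDerivAt (fderiv ℝ f) (fderiv ℝ (fderiv ℝ f) x) (x + (0 : ℝ) • v) := by
      rw [hx0]; exact hf'.hasFDerivAt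
    have h2 : HasDerivAt (fun t : ℝ => fderiv ℝ f (x + t • v)) (fderiv ℝ (fderiv ℝ f) x v) 0 :=
      h1.comp_hasDerivAt (0 : ℝ) (hγ 0)
    have h3 : HasDerivAt (fun t : ℝ => fderiv ℝ f (x + t • v) v)
        (fderiv ℝ (fderiv ℝ f) x v v) 0 :=
      (ContinuousLinearMap.apply ℝ ℝ v).hasFDerivAt.comp_hasDerivAt (0 : ℝ) h2
    exact h3.deriv
  have hmax' : IsLocalMax (fun t : ℝ => f (x + t • v)) 0 := by
    have := hγc.tendsto
    rw [hx0] at this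
    filter_upwards [this.eventually hmax] with t ht
    simpa using ht
  have hcont : ContinuousAt (fun t : ℝ => f (x + t • v)) 0 := by
    have : ContinuousAt f (x + (0 : ℝ) • v) := by rw [hx0]; exact hf.continuousAt
    exact ContinuousAt.comp (f := fun t : ℝ => x + t • v) this hγc
  have hmin := isLocalMin_of_deriv_deriv_pos (by rw [hdd]; exact hpos) hmax'.deriv_eq_zero hcont
  have hconst : (fun t : ℝ => f (x + t • v)) =ᶠ[𝓝 0] fun _ => f (x + (0 : ℝ) • v) := by
    filter_upwards [hmin, hmax'] with t h1 h2 using le_antisymm h2 h1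
  have h0 : deriv (deriv fun t : ℝ => f (x + t • v)) 0 = 0 := by
    rw [hconst.deriv.deriv_eq]
    simp
  rw [hdd] at h0
  exact hpos.ne' h0

theorem pderiv_pderiv_eq {f : EuclideanSpace ℝ (Fin n) → ℝ} {x : EuclideanSpace ℝ (Fin n)}
    (hf : ContDiffAt ℝ 2 f x) (i j : Fin n) :
    pderiv i (pderiv j f) x = fderiv ℝ (fderiv ℝ f) x (EuclideanSpace.single i 1)
      (EuclideanSpace.single j 1) := by
  have hf' : DifferentiableAt ℝ (fderiv ℝ f) x :=
    (hf.fderiv_right (m := 1) (by norm_num)).differentiableAt (by norm_num)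
  unfold pderiv
  rw [fderiv_clm_apply hf' (differentiableAt_const _)]
  simp

/-- Factor `A = C* C`; the double sum becomes a sum of diagonal values of `B`. -/
theorem sum_mul_bilin_nonpos {E : Type*} [NormedAddCommGroup E] [NormedSpace ℝ E]
    {A : Matrix (Fin n) (Fin n) ℝ} (hA : A.PosSemidef) (B : E →L[ℝ] E →L[ℝ] ℝ)
    (hB : ∀ v, B v v ≤ 0) (w : Fin n → E) : ∑ i, ∑ j, A i j * B (w i) (w j) ≤ 0 := by
  open scoped MatrixOrder ComplexOrder in
  obtain ⟨C, rfl⟩ := CStarAlgebra.nonneg_iff_eq_star_mul_self.mp hA.nonneg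
  have : ∑ i, ∑ j, (star C * C) i j * B (w i) (w j)
      = ∑ k, B (∑ i, C k i • w i) (∑ j, C k j • w j) := by
    simp only [map_sum, map_smul, FunLike.coe_sum, Finset.sum_apply, FunLike.coe_smul,
      Pi.smul_apply, smul_eq_mul, Matrix.mul_apply, Matrix.star_apply, star_trivial,
      Finset.sum_mul, Finset.mul_sum]
    rw [Finset.sum_comm]
    conv_rhs => rw [Finset.sum_comm]
    refine Finset.sum_congr rfl fun j _ => ?_
    rw [Finset.sum_comm]
    refine Finset.sum_congr rfl fun k _ => Finset.sum_congr rfl fun i _ => ?_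
    ring
  rw [this]
  exact Finset.sum_nonpos fun k _ => hB _

theorem ellipticOp_nonpos_of_isLocalMax
    {a : EuclideanSpace ℝ (Fin n) → Matrix (Fin n) (Fin n) ℝ}
    {b : EuclideanSpace ℝ (Fin n) → Fin n → ℝ} {f : EuclideanSpace ℝ (Fin n) → ℝ}
    {x : EuclideanSpace ℝ (Fin n)} (ha : (a x).PosSemidef) (hf : ContDiffAt ℝ 2 f x)
    (hmax : IsLocalMax f x) : ellipticOp a b f x ≤ 0 := by
  have h1 : ∀ j, pderiv j f x = 0 := fun j => by simp [pderiv, hmax.fderiv_eq_zero]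
  simp only [ellipticOp, h1, mul_zero, Finset.sum_const_zero, add_zero, pderiv_pderiv_eq hf]
  exact sum_mul_bilin_nonpos ha _ (fderiv_fderiv_apply_nonpos_of_isLocalMax hf hmax) _

theorem pderiv_add {f g : EuclideanSpace ℝ (Fin n) → ℝ} {x : EuclideanSpace ℝ (Fin n)}
    (hf : DifferentiableAt ℝ f x) (hg : DifferentiableAt ℝ g x) (i : Fin n) :
    pderiv i (fun y => f y + g y) x = pderiv i f x + pderiv i g x := by
  simp [pderiv, fderiv_fun_add hf hg]

theorem pderiv_const_mul {f : EuclideanSpace ℝ (Fin n) → ℝ} {x : EuclideanSpace ℝ (Fin n)}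
    (hf : DifferentiableAt ℝ f x) (c : ℝ) (i : Fin n) :
    pderiv i (fun y => c * f y) x = c * pderiv i f x := by
  simp [pderiv, fderiv_const_mul hf]

theorem pderiv_mul {f g : EuclideanSpace ℝ (Fin n) → ℝ} {x : EuclideanSpace ℝ (Fin n)}
    (hf : DifferentiableAt ℝ f x) (hg : DifferentiableAt ℝ g x) (i : Fin n) :
    pderiv i (fun y => f y * g y) x = pderiv i f x * g x + f x * pderiv i g x := by
  simp [pderiv, fderiv_fun_mul hf hg]
  ring

theorem pderiv_congr {f g : EuclideanSpace ℝ (Fin n) → ℝ} {x : EuclideanSpace ℝ (Fin n)}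
    (h : f =ᶠ[𝓝 x] g) (i : Fin n) : pderiv i f x = pderiv i g x := by
  simp [pderiv, h.fderiv_eq]

theorem ContDiffAt.pderiv {f : EuclideanSpace ℝ (Fin n) → ℝ} {x : EuclideanSpace ℝ (Fin n)}
    {m k : WithTop ℕ∞} (hf : ContDiffAt ℝ k f x) (hmk : m + 1 ≤ k) (i : Fin n) :
    ContDiffAt ℝ m (pderiv i f) x :=
  (hf.fderiv_right hmk).clm_apply contDiffAt_const

/-- Serves twice: to add a small multiple of the barrier, and with `c = -1` for differences of
harmonic functions. -/
theorem ellipticOp_add_const_mul {a : EuclideanSpace ℝ (Fin n) → Matrix (Fin n) (Fin n) ℝ}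
    {b : EuclideanSpace ℝ (Fin n) → Fin n → ℝ} {f g : EuclideanSpace ℝ (Fin n) → ℝ}
    {x : EuclideanSpace ℝ (Fin n)} (hf : ContDiffAt ℝ 2 f x) (hg : ContDiffAt ℝ 2 g x) (c : ℝ) :
    ellipticOp a b (fun y => f y + c * g y) x = ellipticOp a b f x + c * ellipticOp a b g x := by
  have h1 : ∀ j, _root_.pderiv j (fun y => f y + c * g y)
      =ᶠ[𝓝 x] fun y => _root_.pderiv j f y + c * _root_.pderiv j g y := fun j => by
    filter_upwards [hf.eventually (by simp), hg.eventually (by simp)] with y hfy hgy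
    rw [pderiv_add (hfy.differentiableAt (by norm_num))
      ((hgy.differentiableAt (by norm_num)).const_mul c),
      pderiv_const_mul (hgy.differentiableAt (by norm_num))]
  have h2 : ∀ i j, _root_.pderiv i (_root_.pderiv j (fun y => f y + c * g y)) x
      = _root_.pderiv i (_root_.pderiv j f) x + c * _root_.pderiv i (_root_.pderiv j g) x :=
    fun i j => by
      have hf' := (hf.pderiv (m := 1) (by norm_num) j).differentiableAt (by norm_num)
      have hg' := (hg.pderiv (m := 1) (by norm_num) j).differentiableAt (by norm_num)
      rw [pderiv_congr (h1 j), pderiv_add hf' (hg'.const_mul c), pderiv_const_mul hg']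
  simp only [ellipticOp, h2, (h1 _).eq_of_nhds, mul_add, Finset.sum_add_distrib, Finset.mul_sum]
  simp only [mul_left_comm c]
  ring

/-- The Gaussian barrier of Hopf's maximum principle. -/
def hopfBarrier (α : ℝ) (y x : EuclideanSpace ℝ (Fin n)) : ℝ := Real.exp (-α * ‖x - y‖ ^ 2)

theorem contDiff_hopfBarrier (α : ℝ) (y : EuclideanSpace ℝ (Fin n)) {k : WithTop ℕ∞} :
    ContDiff ℝ k (hopfBarrier α y) := by
  unfold hopfBarrier
  exact (contDiff_const.mul ((contDiff_id.sub contDiff_const).norm_sq ℝ)).exp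

theorem pderiv_hopfBarrier (α : ℝ) (y : EuclideanSpace ℝ (Fin n)) (j : Fin n) :
    pderiv j (hopfBarrier α y) = fun x => -2 * α * (x j - y j) * hopfBarrier α y x := by
  ext x
  have h1 : HasFDerivAt (fun x : EuclideanSpace ℝ (Fin n) => ‖x - y‖ ^ 2)
      (2 • (innerSL ℝ (x - y)).comp (ContinuousLinearMap.id ℝ _)) x :=
    ((hasFDerivAt_id x).sub_const y).norm_sq
  have h2 := (h1.const_mul (-α)).exp
  unfold pderiv hopfBarrier
  rw [h2.fderiv]
  simp [EuclideanSpace.inner_single_right]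
  ring

theorem pderiv_coord (i j : Fin n) (c : ℝ) (x : EuclideanSpace ℝ (Fin n)) :
    pderiv i (fun x : EuclideanSpace ℝ (Fin n) => x j - c) x = if i = j then 1 else 0 := by
  have : HasFDerivAt (fun x : EuclideanSpace ℝ (Fin n) => x j - c)
      (EuclideanSpace.proj j : EuclideanSpace ℝ (Fin n) →L[ℝ] ℝ) x :=
    (EuclideanSpace.proj j : EuclideanSpace ℝ (Fin n) →L[ℝ] ℝ).hasFDerivAt.sub_const c
  rw [pderiv, this.fderiv]
  simp [eq_comm]

theorem pderiv_pderiv_hopfBarrier (α : ℝ) (y : EuclideanSpace ℝ (Fin n)) (i j : Fin n)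
    (x : EuclideanSpace ℝ (Fin n)) :
    pderiv i (pderiv j (hopfBarrier α y)) x =
      (4 * α ^ 2 * ((x i - y i) * (x j - y j)) - 2 * α * (if i = j then 1 else 0))
        * hopfBarrier α y x := by
  have hd : DifferentiableAt ℝ (fun x : EuclideanSpace ℝ (Fin n) => x j - y j) x := by fun_prop
  rw [pderiv_hopfBarrier, pderiv_mul (hd.const_mul _)
    ((contDiff_hopfBarrier α y (k := 1)).differentiable (by norm_num) x),
    pderiv_const_mul hd, pderiv_coord, pderiv_hopfBarrier]
  ring

/-- The quadratic form enters with `α²`, the trace and the drift only with `α`. Where the form is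
positive, a large `α` therefore makes the value positive. -/
theorem ellipticOp_hopfBarrier (a : EuclideanSpace ℝ (Fin n) → Matrix (Fin n) (Fin n) ℝ)
    (b : EuclideanSpace ℝ (Fin n) → Fin n → ℝ) (α : ℝ) (y x : EuclideanSpace ℝ (Fin n)) :
    ellipticOp a b (hopfBarrier α y) x =
      (4 * α ^ 2 * (∑ i, ∑ j, a x i j * ((x i - y i) * (x j - y j)))
        - 2 * α * ((∑ i, a x i i) + ∑ j, b x j * (x j - y j))) * hopfBarrier α y x := by
  simp only [ellipticOp, pderiv_pderiv_hopfBarrier]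
  have h1 : ∀ i, ∑ j, a x i j * ((4 * α ^ 2 * ((x i - y i) * (x j - y j))
      - 2 * α * (if i = j then 1 else 0)) * hopfBarrier α y x)
      = (4 * α ^ 2 * (∑ j, a x i j * ((x i - y i) * (x j - y j))) - 2 * α * a x i i)
        * hopfBarrier α y x := fun i => by
    have : 2 * α * a x i i = ∑ j, 2 * α * a x i j * (if i = j then 1 else 0) := by simp
    rw [this, Finset.mul_sum, ← Finset.sum_sub_distrib, Finset.sum_mul]
    exact Finset.sum_congr rfl fun j _ => by ring
  simp only [h1]
  rw [← Finset.sum_mul, Finset.sum_sub_distrib, ← Finset.mul_sum, ← Finset.mul_sum]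
  have h2 : ∑ j, b x j * pderiv j (hopfBarrier α y) x
      = -2 * α * (∑ j, b x j * (x j - y j)) * hopfBarrier α y x := by
    rw [Finset.mul_sum, Finset.sum_mul]
    exact Finset.sum_congr rfl fun j _ => by rw [pderiv_hopfBarrier]; ring
  rw [h2]
  ring

end EuclideanMaximumPrinciple

/-! ### Hopf's strong maximum principle -/

section StrongMaximumPrinciple

variable {n : ℕ}

/-- If `f` solves an elliptic equation, `f z = m` and `f < m` on a closed ball with `z` on its
boundary, except at `z`, then `f` exceeds `m` somewhere near `z`. -/
theorem not_forall_le_of_touching_ball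
    {a : EuclideanSpace ℝ (Fin n) → Matrix (Fin n) (Fin n) ℝ}
    {b : EuclideanSpace ℝ (Fin n) → Fin n → ℝ} {f : EuclideanSpace ℝ (Fin n) → ℝ}
    {U : Set (EuclideanSpace ℝ (Fin n))} (hU : IsOpen U)
    (ha : ∀ i j, ContinuousOn (fun x => a x i j) U) (hb : ∀ j, ContinuousOn (fun x => b x j) U)
    (hpos : ∀ x ∈ U, (a x).PosDef) (hf : ContDiffOn ℝ 2 f U)
    (hL : ∀ x ∈ U, ellipticOp a b f x = 0) {m : ℝ} (hm : ∀ x ∈ U, f x ≤ m)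
    {y z : EuclideanSpace ℝ (Fin n)} (hz : z ∈ U) (hyz : y ≠ z) (hfz : f z = m)
    (hball : ∀ x ∈ U, dist x y ≤ dist z y → x ≠ z → f x < m) : False := by
  set w : EuclideanSpace ℝ (Fin n) := z - y with hw
  have hw0 : (WithLp.ofLp w) ≠ 0 := by
    intro h
    exact hyz (sub_eq_zero.1 (show z - y = 0 from (WithLp.ofLp_eq_zero 2).1 h)).symm
  set Q : ℝ := ∑ i, ∑ j, a z i j * ((z i - y i) * (z j - y j)) with hQ
  have hQpos : 0 < Q := by
    have h := (Matrix.posDef_iff_dotProduct_mulVec.1 (hpos z hz)).2 hw0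
    refine h.trans_eq ?_
    simp only [dotProduct, Matrix.mulVec, Pi.star_apply, star_trivial, Finset.mul_sum, hQ, hw]
    refine Finset.sum_congr rfl fun i _ => Finset.sum_congr rfl fun j _ => ?_
    simp only [PiLp.sub_apply]
    ring
  set c : ℝ := (∑ i, a z i i) + ∑ j, b z j * (z j - y j) with hc
  -- Chosen so that `2 α Q - c = 2 (|c| + 1) - c > 0`: the quadratic term dominates at `z`.
  set α : ℝ := (|c| + 1) / Q with hα
  have hαpos : 0 < α := by positivity
  have hLz : 0 < ellipticOp a b (hopfBarrier α y) z := by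
    rw [ellipticOp_hopfBarrier]
    refine mul_pos ?_ (Real.exp_pos _)
    rw [← hQ, ← hc]
    have h1 : α * Q = |c| + 1 := by rw [hα]; field_simp
    have h2 : 4 * α ^ 2 * Q - 2 * α * c = 2 * α * (2 * (α * Q) - c) := by ring
    rw [h2, h1]
    have := le_abs_self c
    have := abs_nonneg c
    have : 0 < 2 * (|c| + 1) - c := by linarith
    positivity
  have hcoord : ∀ j, ContinuousOn (fun x : EuclideanSpace ℝ (Fin n) => x j - y j) U :=
    fun j => by fun_prop
  have hcontL : ContinuousOn (ellipticOp a b (hopfBarrier α y)) U := by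
    have heq : ellipticOp a b (hopfBarrier α y) = fun x => _ :=
      funext fun x => ellipticOp_hopfBarrier a b α y x
    rw [heq]
    refine ContinuousOn.mul (ContinuousOn.sub ?_ ?_)
      (contDiff_hopfBarrier α y (k := 0)).continuous.continuousOn
    · exact continuousOn_const.mul (continuousOn_finsetSum _ fun i _ =>
        continuousOn_finsetSum _ fun j _ => (ha i j).mul ((hcoord i).mul (hcoord j)))
    · exact continuousOn_const.mul ((continuousOn_finsetSum _ fun i _ => ha i i).add
        (continuousOn_finsetSum _ fun j _ => (hb j).mul (hcoord j)))
  have hev : ∀ᶠ x in 𝓝 z, x ∈ U ∧ 0 < ellipticOp a b (hopfBarrier α y) x :=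
    Filter.Eventually.and (hU.mem_nhds hz) ((hcontL.continuousAt (hU.mem_nhds hz)).eventually_const_lt hLz)
  obtain ⟨r, hr, hrU⟩ := Metric.nhds_basis_closedBall.eventually_iff.1 hev
  have hfc : ContinuousOn f (Metric.closedBall z r) := hf.continuousOn.mono fun x hx => (hrU hx).1
  -- The part of the small sphere lying in the touching ball is compact and misses `z`, so `f` stays
  -- below `m` there by a fixed amount.
  obtain ⟨δ, hδ, hK⟩ : ∃ δ > 0, ∀ x ∈ Metric.sphere z r, dist x y ≤ dist z y → f x ≤ m - δ := by
    have hKc : IsCompact (Metric.sphere z r ∩ Metric.closedBall y (dist z y)) :=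
      (isCompact_sphere z r).inter_right Metric.isClosed_closedBall
    rcases (Metric.sphere z r ∩ Metric.closedBall y (dist z y)).eq_empty_or_nonempty with he | hne
    · refine ⟨1, one_pos, fun x hx hxy => ?_⟩
      exact absurd (show x ∈ Metric.sphere z r ∩ Metric.closedBall y (dist z y) from ⟨hx, hxy⟩)
        (by simp [he])
    · obtain ⟨p, hp, hmax⟩ := hKc.exists_isMaxOn hne
        (hfc.mono (Set.inter_subset_left.trans Metric.sphere_subset_closedBall))
      have hpz : p ≠ z := by
        rintro rfl
        have := hp.1
        rw [Metric.mem_sphere, dist_self] at this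
        exact hr.ne this
      have hplt := hball p (hrU (Metric.sphere_subset_closedBall hp.1)).1 hp.2 hpz
      refine ⟨m - f p, by linarith, fun x hx hxy => ?_⟩
      have := hmax (show x ∈ _ from ⟨hx, hxy⟩)
      simp only [Set.mem_ofPred_eq] at this
      linarith
  -- The barrier is at most `1`, so adding `ε` times it cannot use up the gap `δ`. On the rest of
  -- the sphere the barrier is smaller than at `z` and `f ≤ m`. Hence the perturbed function has its
  -- maximum over the closed ball inside, where the operator would be both nonpositive and positive.
  set ε : ℝ := δ / 2 with hε
  have hεpos : 0 < ε := by positivity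
  set F : EuclideanSpace ℝ (Fin n) → ℝ := fun x => f x + ε * hopfBarrier α y x with hF
  have hFc : ContinuousOn F (Metric.closedBall z r) :=
    hfc.add (continuousOn_const.mul (contDiff_hopfBarrier α y (k := 0)).continuous.continuousOn)
  obtain ⟨p, hp, hmax⟩ := (isCompact_closedBall z r).exists_isMaxOn
    ⟨z, Metric.mem_closedBall_self hr.le⟩ hFc
  have hpF : F z ≤ F p := hmax (Metric.mem_closedBall_self hr.le)
  have hpball : p ∈ Metric.ball z r := by
    by_contra hpn
    have hps : p ∈ Metric.sphere z r := by
      rw [Metric.mem_sphere]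
      exact le_antisymm hp (not_lt.1 hpn)
    have hzpos : 0 < hopfBarrier α y z := Real.exp_pos _
    simp only [hF, hfz] at hpF
    by_cases hpy : dist p y ≤ dist z y
    · have h1 := hK p hps hpy
      have h2 : hopfBarrier α y p ≤ 1 := by
        refine Real.exp_le_one_iff.2 ?_
        have : 0 ≤ α * ‖p - y‖ ^ 2 := by positivity
        linarith
      have h3 : ε * hopfBarrier α y p ≤ ε * 1 := by gcongr
      have h4 : 0 < ε * hopfBarrier α y z := by positivity
      linarith
    · have h1 : hopfBarrier α y p < hopfBarrier α y z := by
        refine Real.exp_lt_exp.2 ?_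
        rw [not_le, dist_eq_norm, dist_eq_norm] at hpy
        have : ‖z - y‖ ^ 2 < ‖p - y‖ ^ 2 := by gcongr
        nlinarith
      have h2 : ε * hopfBarrier α y p < ε * hopfBarrier α y z := by gcongr
      have h3 := hm p (hrU hp).1
      linarith
  have hpU := hrU hp
  have hfp : ContDiffAt ℝ 2 f p := hf.contDiffAt (hU.mem_nhds hpU.1)
  have hgp : ContDiffAt ℝ 2 (hopfBarrier α y) p := (contDiff_hopfBarrier α y).contDiffAt
  have hFmax : IsLocalMax F p :=
    (hmax.on_subset Metric.ball_subset_closedBall).isLocalMax (Metric.isOpen_ball.mem_nhds hpball)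
  have h1 : ellipticOp a b F p ≤ 0 :=
    ellipticOp_nonpos_of_isLocalMax (hpos p hpU.1).posSemidef
      (hfp.add (contDiffAt_const.mul hgp)) hFmax
  rw [hF, ellipticOp_add_const_mul hfp hgp, hL p hpU.1] at h1
  have := mul_pos hεpos hpU.2
  linarith

/-- Hopf's strong maximum principle, local form. -/
theorem eventually_eq_of_ellipticOp_eq_zero
    {a : EuclideanSpace ℝ (Fin n) → Matrix (Fin n) (Fin n) ℝ}
    {b : EuclideanSpace ℝ (Fin n) → Fin n → ℝ} {f : EuclideanSpace ℝ (Fin n) → ℝ}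
    {U : Set (EuclideanSpace ℝ (Fin n))} (hU : IsOpen U)
    (ha : ∀ i j, ContinuousOn (fun x => a x i j) U) (hb : ∀ j, ContinuousOn (fun x => b x j) U)
    (hpos : ∀ x ∈ U, (a x).PosDef) (hf : ContDiffOn ℝ 2 f U)
    (hL : ∀ x ∈ U, ellipticOp a b f x = 0) {m : ℝ} (hm : ∀ x ∈ U, f x ≤ m)
    {x₀ : EuclideanSpace ℝ (Fin n)} (hx₀ : x₀ ∈ U) (hfx₀ : f x₀ = m) :
    ∀ᶠ x in 𝓝 x₀, f x = m := by
  obtain ⟨s, hs, hsU⟩ := Metric.nhds_basis_closedBall.mem_iff.1 (hU.mem_nhds hx₀)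
  by_contra hne
  rw [Metric.eventually_nhds_iff_ball] at hne
  push Not at hne
  -- With `y` within `s / 2` of `x₀`, every point closer to `y` than the nearest point of `S` stays
  -- in the ball of radius `s`, so it cannot have the value `m`.
  obtain ⟨y, hy, hfy⟩ := hne (s / 2) (by positivity)
  set S : Set (EuclideanSpace ℝ (Fin n)) := Metric.closedBall x₀ s ∩ f ⁻¹' {m} with hS
  have hSc : IsCompact S := (isCompact_closedBall x₀ s).of_isClosed_subset
    ((hf.continuousOn.mono hsU).preimage_isClosed_of_isClosed Metric.isClosed_closedBall
      isClosed_singleton) Set.inter_subset_left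
  obtain ⟨z, hz, hmin⟩ := hSc.exists_isMinOn (f := fun x => dist x y)
    ⟨x₀, Metric.mem_closedBall_self hs.le, hfx₀⟩ (by fun_prop)
  have hyz : y ≠ z := by
    rintro rfl
    exact hfy hz.2
  have hzy : dist z y ≤ dist x₀ y := hmin ⟨Metric.mem_closedBall_self hs.le, hfx₀⟩
  have hy' : dist x₀ y < s / 2 := by rwa [dist_comm]
  have hlt : ∀ x ∈ U, dist x y < dist z y → f x < m := fun x hx hxy => by
    refine lt_of_le_of_ne (hm x hx) fun h => ?_
    have hxS : x ∈ S := by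
      refine ⟨?_, h⟩
      rw [Metric.mem_closedBall]
      have := dist_triangle x y x₀
      rw [dist_comm y x₀] at this
      linarith
    exact absurd (hmin hxS) (not_le.2 hxy)
  -- The ball about `y` through `z` may meet `{f = m}` at several points of its sphere. The ball of
  -- half the radius about the midpoint touches that sphere only at `z`.
  set y' := midpoint ℝ y z with hy'def
  have hmid : dist z y' = dist z y / 2 := by
    rw [hy'def, dist_comm, dist_midpoint_right, dist_comm y z]
    simp
    ring
  have hmid' : dist y' y = dist z y / 2 := by
    rw [hy'def, dist_midpoint_left, dist_comm y z]
    simp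
    ring
  refine not_forall_le_of_touching_ball hU ha hb hpos hf hL hm (hsU hz.1) (y := y') ?_ hz.2
    fun x hx hxy hxz => ?_
  · intro h
    rw [h, dist_self] at hmid
    have := dist_pos.2 hyz.symm
    linarith
  · refine hlt x hx (lt_of_le_of_ne ?_ fun h => hxz ?_)
    · have := dist_triangle x y' y
      linarith
    · have hyx : dist x y' = dist z y / 2 := by
        have := dist_triangle x y' y
        linarith
      -- Equality in the triangle inequality: by strict convexity `y'` is also the midpoint of `x`
      -- and `y`, which forces `x = z`.
      have h1 : y' = midpoint ℝ x y := by
        apply eq_midpoint_of_dist_eq_half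
        · rw [h, hyx]
        · rw [h, hmid']
      have h2 : midpoint ℝ x y = midpoint ℝ z y := by rw [← h1, hy'def, midpoint_comm]
      exact by simpa [sub_eq_zero] using (midpoint_eq_midpoint_iff_vsub_eq_vsub ℝ).1 h2

end StrongMaximumPrinciple

/-! ### Divergence form operators and their conformal change -/

section DivergenceForm

variable {n : ℕ}

/-- The divergence form operator `∑ i j, ∂_i (A_ij ∂_j f)`. -/
def divergenceOp (A : EuclideanSpace ℝ (Fin n) → Matrix (Fin n) (Fin n) ℝ)
    (f : EuclideanSpace ℝ (Fin n) → ℝ) (x : EuclideanSpace ℝ (Fin n)) : ℝ :=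
  ∑ i, ∑ j, pderiv i (fun y => A y i j * pderiv j f y) x

theorem divergenceOp_eq_sum {A : EuclideanSpace ℝ (Fin n) → Matrix (Fin n) (Fin n) ℝ}
    {f : EuclideanSpace ℝ (Fin n) → ℝ} {x : EuclideanSpace ℝ (Fin n)}
    (hA : ∀ i j, DifferentiableAt ℝ (fun y => A y i j) x) (hf : ContDiffAt ℝ 2 f x) :
    divergenceOp A f x = ∑ i, ∑ j, (pderiv i (fun y => A y i j) x * pderiv j f x
      + A x i j * pderiv i (pderiv j f) x) := by
  refine Finset.sum_congr rfl fun i _ => Finset.sum_congr rfl fun j _ => ?_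
  exact pderiv_mul (hA i j) ((hf.pderiv (m := 1) (by norm_num) j).differentiableAt (by norm_num)) i

theorem divergenceOp_eq_ellipticOp {A : EuclideanSpace ℝ (Fin n) → Matrix (Fin n) (Fin n) ℝ}
    {f : EuclideanSpace ℝ (Fin n) → ℝ} {x : EuclideanSpace ℝ (Fin n)}
    (hA : ∀ i j, DifferentiableAt ℝ (fun y => A y i j) x) (hf : ContDiffAt ℝ 2 f x) :
    divergenceOp A f x
      = ellipticOp A (fun x j => ∑ i, pderiv i (fun y => A y i j) x) f x := by
  rw [divergenceOp_eq_sum hA hf, ellipticOp]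
  simp only [Finset.sum_add_distrib, Finset.sum_mul]
  rw [add_comm]
  congr 1
  exact Finset.sum_comm

theorem eventually_eq_of_divergenceOp_eq_zero
    {A : EuclideanSpace ℝ (Fin n) → Matrix (Fin n) (Fin n) ℝ}
    {f : EuclideanSpace ℝ (Fin n) → ℝ} {U : Set (EuclideanSpace ℝ (Fin n))} (hU : IsOpen U)
    (hA : ∀ i j, ContDiffOn ℝ 1 (fun x => A x i j) U)
    (hpos : ∀ x ∈ U, (A x).PosDef) (hf : ContDiffOn ℝ 2 f U)
    (hL : ∀ x ∈ U, divergenceOp A f x = 0) {m : ℝ} (hm : ∀ x ∈ U, f x ≤ m)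
    {x₀ : EuclideanSpace ℝ (Fin n)} (hx₀ : x₀ ∈ U) (hfx₀ : f x₀ = m) :
    ∀ᶠ x in 𝓝 x₀, f x = m := by
  refine eventually_eq_of_ellipticOp_eq_zero hU (fun i j => (hA i j).continuousOn) (fun j => ?_)
    hpos hf (fun x hx => ?_) hm hx₀ hfx₀ (b := fun x j => ∑ i, pderiv i (fun y => A y i j) x)
  · refine continuousOn_finsetSum _ fun i _ => fun x hx => ?_
    exact (((hA i j).contDiffAt (hU.mem_nhds hx)).pderiv (m := 0) (by norm_num)
      i).continuousAt.continuousWithinAt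
  · rw [← divergenceOp_eq_ellipticOp _ (hf.contDiffAt (hU.mem_nhds hx)), hL x hx]
    exact fun i j => ((hA i j).contDiffAt (hU.mem_nhds hx)).differentiableAt (by norm_num)

/-- The conformal change of a divergence form operator:
`∑ ∂_i (u² A_ij ∂_j f) = u ∑ ∂_i (A_ij ∂_j (u f)) - u f ∑ ∂_i (A_ij ∂_j u)`. -/
theorem divergenceOp_sq_mul {A : EuclideanSpace ℝ (Fin n) → Matrix (Fin n) (Fin n) ℝ}
    {u f : EuclideanSpace ℝ (Fin n) → ℝ} {x : EuclideanSpace ℝ (Fin n)}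
    (hA : ∀ i j, DifferentiableAt ℝ (fun y => A y i j) x) (hsymm : ∀ i j, A x i j = A x j i)
    (hu : ContDiffAt ℝ 2 u x) (hf : ContDiffAt ℝ 2 f x) :
    divergenceOp (fun y => u y ^ 2 • A y) f x
      = u x * divergenceOp A (fun y => u y * f y) x
        - u x * f x * divergenceOp A u x := by
  have hud := hu.differentiableAt (by norm_num)
  have hfd := hf.differentiableAt (by norm_num)
  have hud' : ∀ j, DifferentiableAt ℝ (pderiv j u) x := fun j =>
    (hu.pderiv (m := 1) (by norm_num) j).differentiableAt (by norm_num)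
  have hfd' : ∀ j, DifferentiableAt ℝ (pderiv j f) x := fun j =>
    (hf.pderiv (m := 1) (by norm_num) j).differentiableAt (by norm_num)
  have h1 : ∀ j, pderiv j (fun y => u y * f y)
      =ᶠ[𝓝 x] fun y => pderiv j u y * f y + u y * pderiv j f y := fun j => by
    filter_upwards [hu.eventually (by simp), hf.eventually (by simp)] with y hy hy'
    exact pderiv_mul (hy.differentiableAt (by norm_num)) (hy'.differentiableAt (by norm_num)) j
  have h2 : ∀ i j, pderiv i (pderiv j (fun y => u y * f y)) x
      = pderiv i (pderiv j u) x * f x + pderiv j u x * pderiv i f x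
        + (pderiv i u x * pderiv j f x + u x * pderiv i (pderiv j f) x) := fun i j => by
    rw [pderiv_congr (h1 j), pderiv_add ((hud' j).fun_mul hfd) (hud.fun_mul (hfd' j)),
      pderiv_mul (hud' j) hfd, pderiv_mul hud (hfd' j)]
  have h3 : ∀ i j, pderiv i (fun y => (u y ^ 2 • A y) i j) x
      = 2 * u x * pderiv i u x * A x i j + u x ^ 2 * pderiv i (fun y => A y i j) x := fun i j => by
    simp only [Matrix.smul_apply, smul_eq_mul, pow_two]
    rw [pderiv_mul (hud.fun_mul hud) (hA i j), pderiv_mul hud hud]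
    ring
  -- The product rule yields two cross terms, equal by the symmetry of `A`; together they match the
  -- derivative of `u²`. The two sides of the goal differ exactly by `u` times this identity.
  have h4 : ∑ i, ∑ j, A x i j * (pderiv j u x * pderiv i f x)
      = ∑ i, ∑ j, A x i j * (pderiv i u x * pderiv j f x) := by
    rw [Finset.sum_comm]
    exact Finset.sum_congr rfl fun i _ => Finset.sum_congr rfl fun j _ => by rw [hsymm j i]
  rw [divergenceOp_eq_sum (fun i j => by
      simpa only [Matrix.smul_apply, smul_eq_mul] using (hud.fun_pow 2).fun_mul (hA i j)) hf,
    divergenceOp_eq_sum hA (hu.mul hf), divergenceOp_eq_sum hA hu]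
  simp only [h2, h3, (h1 _).eq_of_nhds]
  have h5 : u x * ∑ i, ∑ j, A x i j * (pderiv j u x * pderiv i f x)
      = u x * ∑ i, ∑ j, A x i j * (pderiv i u x * pderiv j f x) := by rw [h4]
  rw [← sub_eq_zero] at h5 ⊢
  rw [← neg_eq_zero, ← h5]
  simp only [Finset.mul_sum, ← Finset.sum_sub_distrib, ← Finset.sum_neg_distrib]
  refine Finset.sum_congr rfl fun i _ => Finset.sum_congr rfl fun j _ => ?_
  simp only [Matrix.smul_apply, smul_eq_mul]
  ring

theorem divergenceOp_mul_eq_zero {A : EuclideanSpace ℝ (Fin n) → Matrix (Fin n) (Fin n) ℝ}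
    {u f : EuclideanSpace ℝ (Fin n) → ℝ} {x : EuclideanSpace ℝ (Fin n)}
    (hA : ∀ i j, DifferentiableAt ℝ (fun y => A y i j) x) (hsymm : ∀ i j, A x i j = A x j i)
    (hu : ContDiffAt ℝ 2 u x) (hf : ContDiffAt ℝ 2 f x) (hux : u x ≠ 0)
    (h1 : divergenceOp (fun y => u y ^ 2 • A y) f x = 0) (h2 : divergenceOp A u x = 0) :
    divergenceOp A (fun y => u y * f y) x = 0 := by
  rw [divergenceOp_sq_mul hA hsymm hu hf, h2, mul_zero, sub_zero] at h1
  exact (mul_eq_zero.1 h1).resolve_left hux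

end DivergenceForm

/-! ### Smoothness of determinants and inverses -/

section MatrixCalculus

variable {E : Type*} [NormedAddCommGroup E] [NormedSpace ℝ E] {ι : Type*} [Fintype ι]
  [DecidableEq ι] {k : WithTop ℕ∞} {s : Set E}

theorem ContDiffOn.matrix_det {G : E → Matrix ι ι ℝ}
    (hG : ∀ i j, ContDiffOn ℝ k (fun x => G x i j) s) : ContDiffOn ℝ k (fun x => (G x).det) s := by
  simp only [Matrix.det_apply']
  exact ContDiffOn.sum fun σ _ => contDiffOn_const.mul (contDiffOn_prod fun i _ => hG _ _)

/-- Cramer's rule: the entries of the adjugate are determinants. -/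
theorem ContDiffOn.matrix_inv {G : E → Matrix ι ι ℝ}
    (hG : ∀ i j, ContDiffOn ℝ k (fun x => G x i j) s) (hdet : ∀ x ∈ s, (G x).det ≠ 0) (i j : ι) :
    ContDiffOn ℝ k (fun x => (G x)⁻¹ i j) s := by
  simp only [Matrix.inv_def, Matrix.smul_apply, smul_eq_mul, Ring.inverse_eq_inv',
    Matrix.adjugate_apply]
  refine ((ContDiffOn.matrix_det hG).inv hdet).mul (ContDiffOn.matrix_det fun a b => ?_)
  by_cases h : a = j
  · subst h
    simpa using contDiffOn_const
  · simpa [Matrix.updateRow_ne h] using hG a b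

end MatrixCalculus

/-! ### The metric and the Laplacian in a chart -/

section ChartCalculus

variable {n : ℕ} [NeZero n] {M : Type*} [TopologicalSpace M]
  [ChartedSpace (EuclideanHalfSpace n) M] [IsManifold (𝓡∂ n) ∞ M]
  {e : OpenPartialHomeomorph M (EuclideanHalfSpace n)}

theorem extend_target_mem_nhdsWithin_range {x : EuclideanSpace ℝ (Fin n)}
    (hx : x ∈ (e.extend (𝓡∂ n)).target) :
    (e.extend (𝓡∂ n)).target ∈ 𝓝[Set.range (𝓡∂ n)] x := by
  have h : (e.extend (𝓡∂ n)).symm x ∈ e.source := by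
    simpa using (e.extend (𝓡∂ n)).map_target hx
  have := e.extend_target_mem_nhdsWithin (I := 𝓡∂ n) h
  rwa [(e.extend (𝓡∂ n)).right_inv hx] at this

/-- The chart target is relatively open in the half-space, so one-sided derivatives within either
set agree. -/
theorem nhdsWithin_extend_target {x : EuclideanSpace ℝ (Fin n)}
    (hx : x ∈ (e.extend (𝓡∂ n)).target) :
    𝓝[(e.extend (𝓡∂ n)).target] x = 𝓝[Set.range (𝓡∂ n)] x :=
  le_antisymm (nhdsWithin_mono _ (e.extend_target_subset_range (I := 𝓡∂ n)))
    (nhdsWithin_le_of_mem (extend_target_mem_nhdsWithin_range hx))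

theorem uniqueDiffOn_extend_target : UniqueDiffOn ℝ (e.extend (𝓡∂ n)).target := fun x hx => by
  have : UniqueDiffWithinAt ℝ (Set.range (𝓡∂ n)) x :=
    (𝓡∂ n).uniqueDiffOn x (e.extend_target_subset_range (I := 𝓡∂ n) hx)
  exact this.mono_nhds (nhdsWithin_extend_target hx).ge

theorem contMDiffOn_extend_symm_target (he : e ∈ IsManifold.maximalAtlas (𝓡∂ n) ∞ M) :
    ContMDiffOn 𝓘(ℝ, EuclideanSpace ℝ (Fin n)) (𝓡∂ n) ∞ (e.extend (𝓡∂ n)).symm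
      (e.extend (𝓡∂ n)).target := by
  rw [e.extend_target']
  exact contMDiffOn_extend_symm he

theorem contDiffOn_comp_extend_symm (he : e ∈ IsManifold.maximalAtlas (𝓡∂ n) ∞ M) {f : M → ℝ}
    (hf : ContMDiff (𝓡∂ n) 𝓘(ℝ, ℝ) ∞ f) :
    ContDiffOn ℝ ∞ (f ∘ (e.extend (𝓡∂ n)).symm) (e.extend (𝓡∂ n)).target :=
  (hf.comp_contMDiffOn (contMDiffOn_extend_symm_target he)).contDiffOn

theorem mdifferentiableWithinAt_extend_symm (he : e ∈ IsManifold.maximalAtlas (𝓡∂ n) ∞ M)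
    {x : EuclideanSpace ℝ (Fin n)} (hx : x ∈ (e.extend (𝓡∂ n)).target) :
    MDifferentiableWithinAt 𝓘(ℝ, EuclideanSpace ℝ (Fin n)) (𝓡∂ n) (e.extend (𝓡∂ n)).symm
      (Set.range (𝓡∂ n)) x :=
  ((contMDiffOn_extend_symm_target he x hx).mdifferentiableWithinAt (by simp)).mono_of_mem_nhdsWithin
    (extend_target_mem_nhdsWithin_range hx)

/-- The differential of the inverse chart. -/
def chartFrame (e : OpenPartialHomeomorph M (EuclideanHalfSpace n))
    (x : EuclideanSpace ℝ (Fin n)) :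
    EuclideanSpace ℝ (Fin n) →L[ℝ] TangentSpace (𝓡∂ n) ((e.extend (𝓡∂ n)).symm x) :=
  mfderivWithin 𝓘(ℝ, EuclideanSpace ℝ (Fin n)) (𝓡∂ n) (e.extend (𝓡∂ n)).symm (Set.range (𝓡∂ n)) x

theorem mfderivWithin_target_eq_chartFrame {x : EuclideanSpace ℝ (Fin n)}
    (hx : x ∈ (e.extend (𝓡∂ n)).target) :
    mfderivWithin 𝓘(ℝ, EuclideanSpace ℝ (Fin n)) (𝓡∂ n) (e.extend (𝓡∂ n)).symm
      (e.extend (𝓡∂ n)).target x = chartFrame e x :=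
  mfderivWithin_congr_set (nhdsWithin_eq_iff_eventuallyEq.1 (nhdsWithin_extend_target hx))

theorem chartMetricCoeff_apply (g : SmoothMetric n M) (x : EuclideanSpace ℝ (Fin n))
    (i j : Fin n) : chartMetricCoeff g e x i j =
      g.inner ((e.extend (𝓡∂ n)).symm x) (chartFrame e x (EuclideanSpace.single i 1))
        (chartFrame e x (EuclideanSpace.single j 1)) := rfl

/-- The frame is the tangent map of the inverse chart applied to a constant vector field. -/
theorem contMDiffOn_chartFrame (he : e ∈ IsManifold.maximalAtlas (𝓡∂ n) ∞ M)
    (v : EuclideanSpace ℝ (Fin n)) :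
    ContMDiffOn 𝓘(ℝ, EuclideanSpace ℝ (Fin n)) ((𝓡∂ n).prod 𝓘(ℝ, EuclideanSpace ℝ (Fin n))) ∞
      (fun x => Bundle.TotalSpace.mk' (EuclideanSpace ℝ (Fin n)) (E := TangentSpace (𝓡∂ n) (M := M))
        ((e.extend (𝓡∂ n)).symm x) (chartFrame e x v)) (e.extend (𝓡∂ n)).target := by
  have : IsManifold (𝓡∂ n) 1 M := IsManifold.of_le (n := ∞) (by simp)
  have h1 := (contMDiffOn_extend_symm_target he).contMDiffOn_tangentMapWithin (m := ∞)
    (by simp) uniqueDiffOn_extend_target.uniqueMDiffOn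
  have h2 : ContMDiffOn 𝓘(ℝ, EuclideanSpace ℝ (Fin n))
      (𝓘(ℝ, EuclideanSpace ℝ (Fin n)).prod 𝓘(ℝ, EuclideanSpace ℝ (Fin n))) ∞
      (fun x => (⟨x, v⟩ : TangentBundle 𝓘(ℝ, EuclideanSpace ℝ (Fin n)) (EuclideanSpace ℝ (Fin n))))
      (e.extend (𝓡∂ n)).target :=
    contMDiffOn_vectorSpace_iff_contDiffOn.2 contDiffOn_const
  refine (h1.comp h2 fun x hx => hx).congr fun x hx => ?_
  simp only [tangentMapWithin, Function.comp, mfderivWithin_target_eq_chartFrame hx]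
  rfl

theorem contDiffOn_chartMetricCoeff (g : SmoothMetric n M)
    (he : e ∈ IsManifold.maximalAtlas (𝓡∂ n) ∞ M) (i j : Fin n) :
    ContDiffOn ℝ ∞ (fun x => chartMetricCoeff g e x i j) (e.extend (𝓡∂ n)).target := by
  have h1 := g.contMDiff.comp_contMDiffOn (contMDiffOn_extend_symm_target he)
  have h2 := ContMDiffOn.clm_bundle_apply₂ (F₁ := EuclideanSpace ℝ (Fin n))
    (F₂ := EuclideanSpace ℝ (Fin n)) (F₃ := ℝ) (E₃ := Bundle.Trivial M ℝ) h1
    (contMDiffOn_chartFrame he (EuclideanSpace.single i 1))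
    (contMDiffOn_chartFrame he (EuclideanSpace.single j 1))
  intro x hx
  have h3 := h2 x hx
  rw [Bundle.contMDiffWithinAt_totalSpace] at h3
  exact h3.2.contDiffWithinAt

theorem extend_comp_symm_fderiv (he : e ∈ IsManifold.maximalAtlas (𝓡∂ n) ∞ M)
    {x : EuclideanSpace ℝ (Fin n)} (hx : x ∈ (e.extend (𝓡∂ n)).target)
    (v : EuclideanSpace ℝ (Fin n)) :
    mfderiv (𝓡∂ n) 𝓘(ℝ, EuclideanSpace ℝ (Fin n)) (e.extend (𝓡∂ n))
      ((e.extend (𝓡∂ n)).symm x) (chartFrame e x v) = v := by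
  have hs : (e.extend (𝓡∂ n)).symm x ∈ e.source := by
    simpa using (e.extend (𝓡∂ n)).map_target hx
  have hd : MDifferentiableAt (𝓡∂ n) 𝓘(ℝ, EuclideanSpace ℝ (Fin n)) (e.extend (𝓡∂ n))
      ((e.extend (𝓡∂ n)).symm x) := (e.contMDiffAt_extend he hs).mdifferentiableAt (by simp)
  have hu : UniqueDiffWithinAt ℝ (Set.range (𝓡∂ n)) x :=
    (𝓡∂ n).uniqueDiffOn x (e.extend_target_subset_range (I := 𝓡∂ n) hx)
  have h1 := mfderiv_comp_mfderivWithin x hd (mdifferentiableWithinAt_extend_symm he hx)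
    hu.uniqueMDiffWithinAt
  have h2 : (e.extend (𝓡∂ n) ∘ (e.extend (𝓡∂ n)).symm) =ᶠ[𝓝[Set.range (𝓡∂ n)] x] id := by
    filter_upwards [extend_target_mem_nhdsWithin_range hx] with y hy
    exact (e.extend (𝓡∂ n)).right_inv hy
  rw [h2.mfderivWithin_eq ((e.extend (𝓡∂ n)).right_inv hx),
    mfderivWithin_id hu.uniqueMDiffWithinAt] at h1
  exact (DFunLike.congr_fun h1 v).symm

theorem chartFrame_bijective (he : e ∈ IsManifold.maximalAtlas (𝓡∂ n) ∞ M)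
    {x : EuclideanSpace ℝ (Fin n)} (hx : x ∈ (e.extend (𝓡∂ n)).target) :
    Function.Bijective (chartFrame e x) := by
  have hinj : Function.Injective (chartFrame e x) := fun v w h => by
    rw [← extend_comp_symm_fderiv he hx v, h, extend_comp_symm_fderiv he hx w]
  have : FiniteDimensional ℝ (TangentSpace (𝓡∂ n) ((e.extend (𝓡∂ n)).symm x)) :=
    inferInstanceAs (FiniteDimensional ℝ (EuclideanSpace ℝ (Fin n)))
  exact ⟨hinj, (LinearMap.injective_iff_surjective_of_finrank_eq_finrank
    (f := (chartFrame e x).toLinearMap) rfl).1 hinj⟩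

theorem EuclideanSpace.sum_smul_single {n : ℕ} (v : EuclideanSpace ℝ (Fin n)) :
    ∑ i, v i • EuclideanSpace.single i (1 : ℝ) = v := by
  ext j
  simp [Pi.single_apply]

theorem inner_chartFrame (g : SmoothMetric n M) (x v w : EuclideanSpace ℝ (Fin n)) :
    g.inner ((e.extend (𝓡∂ n)).symm x) (chartFrame e x v) (chartFrame e x w)
      = ∑ i, ∑ j, v i * chartMetricCoeff g e x i j * w j := by
  conv_lhs => rw [← EuclideanSpace.sum_smul_single v, ← EuclideanSpace.sum_smul_single w]
  simp only [map_sum, map_smul, FunLike.coe_sum, Finset.sum_apply, FunLike.coe_smul,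
    Pi.smul_apply, smul_eq_mul, chartMetricCoeff_apply, Finset.mul_sum]
  rw [Finset.sum_comm]
  exact Finset.sum_congr rfl fun i _ => Finset.sum_congr rfl fun j _ => by ring

theorem chartMetricCoeff_posDef (g : SmoothMetric n M)
    (he : e ∈ IsManifold.maximalAtlas (𝓡∂ n) ∞ M)
    {x : EuclideanSpace ℝ (Fin n)} (hx : x ∈ (e.extend (𝓡∂ n)).target) :
    (chartMetricCoeff g e x).PosDef := by
  refine Matrix.posDef_iff_dotProduct_mulVec.2 ⟨?_, fun v hv => ?_⟩
  · ext i j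
    simp only [Matrix.conjTranspose_apply, star_trivial, chartMetricCoeff_apply]
    exact g.symm _ _ _
  · have hne : chartFrame e x (WithLp.toLp 2 v) ≠ 0 := fun h => hv <| by
      have := (chartFrame_bijective he hx).1 (h.trans (map_zero _).symm)
      simpa using this
    have := g.pos _ _ hne
    rw [inner_chartFrame] at this
    refine this.trans_eq ?_
    simp only [dotProduct, Matrix.mulVec, Pi.star_apply, star_trivial, Finset.mul_sum]
    exact Finset.sum_congr rfl fun i _ => Finset.sum_congr rfl fun j _ => by ring

/-- The principal coefficients `√(det G) G⁻¹` of the Laplacian in divergence form. -/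
def laplaceCoeff (G : EuclideanSpace ℝ (Fin n) → Matrix (Fin n) (Fin n) ℝ)
    (x : EuclideanSpace ℝ (Fin n)) : Matrix (Fin n) (Fin n) ℝ :=
  √(G x).det • (G x)⁻¹

theorem laplaceCoeff_posDef (g : SmoothMetric n M)
    (he : e ∈ IsManifold.maximalAtlas (𝓡∂ n) ∞ M)
    {x : EuclideanSpace ℝ (Fin n)} (hx : x ∈ (e.extend (𝓡∂ n)).target) :
    (laplaceCoeff (chartMetricCoeff g e) x).PosDef :=
  (chartMetricCoeff_posDef g he hx).inv.smul
    (Real.sqrt_pos.2 (chartMetricCoeff_posDef g he hx).det_pos)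

theorem contDiffOn_laplaceCoeff (g : SmoothMetric n M)
    (he : e ∈ IsManifold.maximalAtlas (𝓡∂ n) ∞ M) (i j : Fin n) :
    ContDiffOn ℝ ∞ (fun x => laplaceCoeff (chartMetricCoeff g e) x i j)
      (e.extend (𝓡∂ n)).target := by
  have hG := contDiffOn_chartMetricCoeff g he
  have hdet : ∀ x ∈ (e.extend (𝓡∂ n)).target, (chartMetricCoeff g e x).det ≠ 0 :=
    fun x hx => (chartMetricCoeff_posDef g he hx).det_pos.ne'
  simp only [laplaceCoeff, Matrix.smul_apply, smul_eq_mul]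
  exact ((ContDiffOn.matrix_det hG).sqrt hdet).mul (ContDiffOn.matrix_inv hG hdet i j)

/-- At interior points one-sided derivatives are ordinary ones, and the nonzero factor `(√(det
G))⁻¹` can be dropped. -/
theorem IsHarmonic.divergenceOp_eq_zero {g : SmoothMetric n M} {f : M → ℝ} (hf : IsHarmonic g f)
    (he : e ∈ IsManifold.maximalAtlas (𝓡∂ n) ∞ M) {x : EuclideanSpace ℝ (Fin n)}
    (hx : x ∈ interior (e.extend (𝓡∂ n)).target) :
    divergenceOp (laplaceCoeff (chartMetricCoeff g e)) (f ∘ (e.extend (𝓡∂ n)).symm) x = 0 := by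
  have hxT := interior_subset hx
  have h := hf.2 e he x hxT
  have hdet := (chartMetricCoeff_posDef g he hxT).det_pos
  rw [coordLaplacian, mul_eq_zero, inv_eq_zero, Real.sqrt_eq_zero hdet.le] at h
  rw [← h.resolve_left hdet.ne', divergenceOp]
  have hS : ∀ y ∈ interior (e.extend (𝓡∂ n)).target, Set.range (𝓡∂ n) ∈ 𝓝 y := fun y hy =>
    mem_of_superset (mem_interior_iff_mem_nhds.1 hy) (e.extend_target_subset_range (I := 𝓡∂ n))
  refine Finset.sum_congr rfl fun i _ => Finset.sum_congr rfl fun j _ => ?_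
  rw [pderivWithin, fderivWithin_of_mem_nhds (hS x hx)]
  refine pderiv_congr ?_ i
  filter_upwards [isOpen_interior.mem_nhds hx] with y hy
  rw [pderivWithin, fderivWithin_of_mem_nhds (hS y hy)]
  rfl

end ChartCalculus

/-! ### Boundary points in arbitrary charts -/

section Boundary

variable {n : ℕ} [NeZero n] {M : Type*} [TopologicalSpace M]
  [ChartedSpace (EuclideanHalfSpace n) M] [IsManifold (𝓡∂ n) ∞ M]
  {e : OpenPartialHomeomorph M (EuclideanHalfSpace n)}

theorem isInteriorPoint_halfSpace_iff (x : EuclideanHalfSpace n) :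
    (𝓡∂ n).IsInteriorPoint x ↔ 0 < x.1 0 := by
  rw [ModelWithCorners.isInteriorPoint_iff_of_mem_atlas (n := ∞) (e := OpenPartialHomeomorph.refl _)
    (by simp) (by simp) (by simp)]
  have : (OpenPartialHomeomorph.refl (EuclideanHalfSpace n)).extend (𝓡∂ n)
      = (𝓡∂ n).toPartialEquiv := by
    ext <;> simp [OpenPartialHomeomorph.extend]
  rw [this, ModelWithCorners.target_eq, interior_range_modelWithCornersEuclideanHalfSpace]
  rfl

/-- A smooth chart and its inverse have surjective differentials, and such maps send interior points
to interior points. Thus any chart of the maximal atlas detects the boundary. -/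
theorem isInteriorPoint_iff_of_mem_maximalAtlas (he : e ∈ IsManifold.maximalAtlas (𝓡∂ n) ∞ M)
    {p : M} (hp : p ∈ e.source) : (𝓡∂ n).IsInteriorPoint p ↔ 0 < (e.extend (𝓡∂ n) p) 0 := by
  have hd : e.MDifferentiable (𝓡∂ n) (𝓡∂ n) :=
    ⟨(contMDiffOn_of_mem_maximalAtlas he).mdifferentiableOn (by simp),
      (contMDiffOn_symm_of_mem_maximalAtlas he).mdifferentiableOn (by simp)⟩
  have : IsManifold (𝓡∂ n) 1 M := IsManifold.of_le (n := ∞) (by simp)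
  rw [show (e.extend (𝓡∂ n) p) 0 = (e p).1 0 from rfl, ← isInteriorPoint_halfSpace_iff]
  refine ⟨fun h => (hd.mdifferentiableAt hp).isInteriorPoint_of_surjective_mfderiv
    (hd.mfderiv_surjective hp) h, fun h => ?_⟩
  have := (hd.mdifferentiableAt_symm (e.map_source hp)).isInteriorPoint_of_surjective_mfderiv
    (hd.symm.mfderiv_surjective (e.map_source hp)) h
  rwa [e.left_inv hp] at this

theorem extend_zero_nonneg (p : M) : 0 ≤ (e.extend (𝓡∂ n) p) 0 := (e p).2

theorem mem_boundary_iff_of_mem_maximalAtlas (he : e ∈ IsManifold.maximalAtlas (𝓡∂ n) ∞ M)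
    {p : M} (hp : p ∈ e.source) :
    p ∈ (𝓡∂ n).boundary M ↔ (e.extend (𝓡∂ n) p) 0 = 0 := by
  change (𝓡∂ n).IsBoundaryPoint p ↔ _
  rw [ModelWithCorners.isBoundaryPoint_iff_not_isInteriorPoint,
    isInteriorPoint_iff_of_mem_maximalAtlas he hp, not_lt]
  exact ⟨fun h => le_antisymm h (extend_zero_nonneg p), fun h => h.le⟩

theorem extend_symm_mem_boundary_iff (he : e ∈ IsManifold.maximalAtlas (𝓡∂ n) ∞ M)
    {x : EuclideanSpace ℝ (Fin n)} (hx : x ∈ (e.extend (𝓡∂ n)).target) :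
    (e.extend (𝓡∂ n)).symm x ∈ (𝓡∂ n).boundary M ↔ x 0 = 0 := by
  have hs : (e.extend (𝓡∂ n)).symm x ∈ e.source := by
    simpa using (e.extend (𝓡∂ n)).map_target hx
  rw [mem_boundary_iff_of_mem_maximalAtlas he hs, (e.extend (𝓡∂ n)).right_inv hx]

theorem extend_mem_interior_target (he : e ∈ IsManifold.maximalAtlas (𝓡∂ n) ∞ M)
    {p : M} (hp : p ∈ e.source) (hpb : p ∉ (𝓡∂ n).boundary M) :
    e.extend (𝓡∂ n) p ∈ interior (e.extend (𝓡∂ n)).target := by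
  refine e.mem_interior_extend_target
    (e.map_source hp) ?_
  rw [interior_range_modelWithCornersEuclideanHalfSpace]
  exact (isInteriorPoint_iff_of_mem_maximalAtlas he hp).1
    (((𝓡∂ n).isInteriorPoint_iff_not_isBoundaryPoint p).2 hpb)

end Boundary

/-! ### Comparison principle on the manifold -/

section Comparison

variable {n : ℕ} [NeZero n] {M : Type*} [TopologicalSpace M]
  [ChartedSpace (EuclideanHalfSpace n) M] [IsManifold (𝓡∂ n) ∞ M]

/-- A smooth function satisfying the Laplace equation of `g` in the interior of every chart. -/
structure IsInteriorHarmonic (g : SmoothMetric n M) (f : M → ℝ) : Prop where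
  contMDiff : ContMDiff (𝓡∂ n) 𝓘(ℝ, ℝ) ∞ f
  divergenceOp_eq_zero : ∀ e ∈ IsManifold.maximalAtlas (𝓡∂ n) ∞ M,
    ∀ x ∈ interior (e.extend (𝓡∂ n)).target,
      divergenceOp (laplaceCoeff (chartMetricCoeff g e)) (f ∘ (e.extend (𝓡∂ n)).symm) x = 0

theorem IsHarmonic.isInteriorHarmonic {g : SmoothMetric n M} {f : M → ℝ} (hf : IsHarmonic g f) :
    IsInteriorHarmonic g f :=
  ⟨hf.1, fun _ he _ hx => hf.divergenceOp_eq_zero he hx⟩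

theorem contDiffAt_comp_extend_symm {e : OpenPartialHomeomorph M (EuclideanHalfSpace n)}
    (he : e ∈ IsManifold.maximalAtlas (𝓡∂ n) ∞ M) {f : M → ℝ}
    (hf : ContMDiff (𝓡∂ n) 𝓘(ℝ, ℝ) ∞ f) {x : EuclideanSpace ℝ (Fin n)}
    (hx : x ∈ interior (e.extend (𝓡∂ n)).target) :
    ContDiffAt ℝ 2 (f ∘ (e.extend (𝓡∂ n)).symm) x :=
  ((contDiffOn_comp_extend_symm he hf).contDiffAt (mem_interior_iff_mem_nhds.1 hx)).of_le
    ENat.LEInfty.out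

theorem differentiableAt_laplaceCoeff (g : SmoothMetric n M)
    {e : OpenPartialHomeomorph M (EuclideanHalfSpace n)}
    (he : e ∈ IsManifold.maximalAtlas (𝓡∂ n) ∞ M) {x : EuclideanSpace ℝ (Fin n)}
    (hx : x ∈ interior (e.extend (𝓡∂ n)).target) (i j : Fin n) :
    DifferentiableAt ℝ (fun y => laplaceCoeff (chartMetricCoeff g e) y i j) x :=
  ((contDiffOn_laplaceCoeff g he i j).contDiffAt
    (mem_interior_iff_mem_nhds.1 hx)).differentiableAt (by simp)

theorem isInteriorHarmonic_zero (g : SmoothMetric n M) : IsInteriorHarmonic g fun _ => 0 :=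
  ⟨contMDiff_const, fun e _ x _ => by
    simp [divergenceOp, pderiv, Function.comp_def]⟩

theorem IsInteriorHarmonic.sub {g : SmoothMetric n M} {f₁ f₂ : M → ℝ}
    (h₁ : IsInteriorHarmonic g f₁) (h₂ : IsInteriorHarmonic g f₂) :
    IsInteriorHarmonic g fun p => f₁ p - f₂ p := by
  refine ⟨h₁.contMDiff.sub h₂.contMDiff, fun e he x hx => ?_⟩
  have hc₁ := contDiffAt_comp_extend_symm he h₁.contMDiff hx
  have hc₂ := contDiffAt_comp_extend_symm he h₂.contMDiff hx
  have hA := differentiableAt_laplaceCoeff g he hx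
  have h : ((fun p => f₁ p - f₂ p) ∘ (e.extend (𝓡∂ n)).symm) = fun y =>
      (f₁ ∘ (e.extend (𝓡∂ n)).symm) y + (-1) * (f₂ ∘ (e.extend (𝓡∂ n)).symm) y := by
    ext y
    simp [sub_eq_add_neg]
  rw [h, divergenceOp_eq_ellipticOp hA (hc₁.add (contDiffAt_const.mul hc₂)),
    ellipticOp_add_const_mul hc₁ hc₂, ← divergenceOp_eq_ellipticOp hA hc₁,
    ← divergenceOp_eq_ellipticOp hA hc₂, h₁.divergenceOp_eq_zero e he x hx,
    h₂.divergenceOp_eq_zero e he x hx]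
  simp

theorem IsInteriorHarmonic.eventually_eq {g : SmoothMetric n M} {f : M → ℝ}
    (hf : IsInteriorHarmonic g f) {p : M} (hp : p ∉ (𝓡∂ n).boundary M) (hmax : ∀ q, f q ≤ f p) :
    ∀ᶠ q in 𝓝 p, f q = f p := by
  set e := chartAt (EuclideanHalfSpace n) p
  have he : e ∈ IsManifold.maximalAtlas (𝓡∂ n) ∞ M := IsManifold.chart_mem_maximalAtlas p
  have hpe : p ∈ e.source := mem_chart_source _ p
  have hx := extend_mem_interior_target he hpe hp
  have hinv : (e.extend (𝓡∂ n)).symm (e.extend (𝓡∂ n) p) = p := e.extend_left_inv hpe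
  have h := eventually_eq_of_divergenceOp_eq_zero isOpen_interior
    (fun i j => ((contDiffOn_laplaceCoeff g he i j).of_le (mod_cast le_top)).mono interior_subset)
    (fun x hx => laplaceCoeff_posDef g he (interior_subset hx))
    (fun x hx => (contDiffAt_comp_extend_symm he hf.contMDiff hx).contDiffWithinAt)
    (hf.divergenceOp_eq_zero e he) (m := f p) (fun x _ => hmax _) hx (by simp only [Function.comp, hinv])
  have hc : ContinuousAt (e.extend (𝓡∂ n)) p := e.continuousAt_extend hpe
  filter_upwards [hc.tendsto.eventually h, e.open_source.mem_nhds hpe] with q hq hqe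
  simpa only [Function.comp, e.extend_left_inv hqe] using hq

/-- The comparison principle for harmonic functions with prescribed limits at infinity. -/
theorem IsInteriorHarmonic.le_of_le_boundary [T2Space M] [ConnectedSpace M]
    (hnonempty : ((𝓡∂ n).boundary M).Nonempty) {g : SmoothMetric n M} {f₁ f₂ : M → ℝ}
    (h₁ : IsInteriorHarmonic g f₁) (h₂ : IsInteriorHarmonic g f₂)
    (hb : ∀ p ∈ (𝓡∂ n).boundary M, f₁ p ≤ f₂ p) {c₁ c₂ : ℝ}
    (hc₁ : TendsToAtInfinity f₁ c₁) (hc₂ : TendsToAtInfinity f₂ c₂) (hc : c₁ ≤ c₂) (q : M) :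
    f₁ q ≤ f₂ q := by
  have hf := h₁.sub h₂
  set f : M → ℝ := fun p => f₁ p - f₂ p with hfdef
  have hlim : Tendsto f (cocompact M) (𝓝 (c₁ - c₂)) := Tendsto.sub hc₁ hc₂
  by_contra! hq
  have hq0 : 0 < f q := sub_pos.2 hq
  have hcont : Continuous f := hf.contMDiff.continuous
  -- Outside a compact set `f` lies below its positive value at `q`, so its supremum is attained
  -- although `M` is not assumed compact.
  have hev : ∀ᶠ x in cocompact M, f x ≤ f q :=
    (hlim.eventually_lt_const (show c₁ - c₂ < f q by linarith)).mono fun x hx => hx.le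
  obtain ⟨p, hp⟩ := hcont.exists_forall_ge' q hev
  have hpos : 0 < f p := hq0.trans_le (hp q)
  have hclopen : IsClopen {x | f x = f p} := by
    refine ⟨isClosed_eq hcont continuous_const, isOpen_iff_mem_nhds.2 fun x hx => ?_⟩
    have hxeq : f x = f p := hx
    have hxb : x ∉ (𝓡∂ n).boundary M := fun h => by
      have := hb x h
      have h3 : f x ≤ 0 := sub_nonpos.2 this
      linarith
    have := hf.eventually_eq hxb fun y => by rw [hxeq]; exact hp y
    rw [hxeq] at this
    exact this
  obtain ⟨z, hz⟩ := hnonempty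
  have hz' : z ∈ {x | f x = f p} := by
    rw [hclopen.eq_univ ⟨p, rfl⟩]
    trivial
  have h3 : f z ≤ 0 := sub_nonpos.2 (hb z hz)
  have h4 : f z = f p := hz'
  linarith

end Comparison

/-! ### Conformal covariance and the relation between the potentials -/

section Conformal

variable {n : ℕ} [NeZero n] {M : Type*} [TopologicalSpace M]
  [ChartedSpace (EuclideanHalfSpace n) M] [IsManifold (𝓡∂ n) ∞ M]
  {e : OpenPartialHomeomorph M (EuclideanHalfSpace n)} {g g' : SmoothMetric n M} {u : M → ℝ}

theorem chartMetricCoeff_conformal {a : M → ℝ}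
    (h : ∀ (p : M) (v w : TangentSpace (𝓡∂ n) p), g'.inner p v w = a p * g.inner p v w)
    (x : EuclideanSpace ℝ (Fin n)) :
    chartMetricCoeff g' e x = a ((e.extend (𝓡∂ n)).symm x) • chartMetricCoeff g e x := by
  ext i j
  simp only [chartMetricCoeff_apply, h, Matrix.smul_apply, smul_eq_mul]

/-- Scaling the metric by `k` multiplies `√det` by `k ^ (n / 2)` and the inverse by `k⁻¹`; for `k =
u ^ (4 / (n - 2))` the product is `u²`. -/
theorem laplaceCoeff_conformal (hn : 3 ≤ n) (hu : ∀ p, 0 < u p)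
    (h : ∀ (p : M) (v w : TangentSpace (𝓡∂ n) p),
      g'.inner p v w = u p ^ (4 / ((n : ℝ) - 2)) * g.inner p v w)
    (he : e ∈ IsManifold.maximalAtlas (𝓡∂ n) ∞ M) {x : EuclideanSpace ℝ (Fin n)}
    (hx : x ∈ (e.extend (𝓡∂ n)).target) :
    laplaceCoeff (chartMetricCoeff g' e) x
      = (u ∘ (e.extend (𝓡∂ n)).symm) x ^ 2 • laplaceCoeff (chartMetricCoeff g e) x := by
  have hdet := (chartMetricCoeff_posDef g he hx).det_pos
  have hv : 0 < u ((e.extend (𝓡∂ n)).symm x) := hu _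
  have hn' : (n : ℝ) - 2 ≠ 0 := by
    have : (3 : ℝ) ≤ n := mod_cast hn
    linarith
  simp only [laplaceCoeff, chartMetricCoeff_conformal h x, Function.comp]
  set v := u ((e.extend (𝓡∂ n)).symm x)
  have hk : 0 < v ^ (4 / ((n : ℝ) - 2)) := Real.rpow_pos_of_pos hv _
  have hinv : (v ^ (4 / ((n : ℝ) - 2)) • chartMetricCoeff g e x)⁻¹
      = (v ^ (4 / ((n : ℝ) - 2)))⁻¹ • (chartMetricCoeff g e x)⁻¹ := by
    have := hdet.ne'
    refine Matrix.inv_eq_right_inv ?_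
    rw [Matrix.smul_mul, Matrix.mul_smul, smul_smul, mul_inv_cancel₀ hk.ne', one_smul,
      Matrix.mul_nonsing_inv _ (isUnit_iff_ne_zero.2 this)]
  rw [hinv, Matrix.det_smul, Fintype.card_fin, Real.sqrt_mul (by positivity), smul_smul, smul_smul]
  congr 1
  have : √((v ^ (4 / ((n : ℝ) - 2))) ^ n) * (v ^ (4 / ((n : ℝ) - 2)))⁻¹ = v ^ 2 := by
    rw [Real.sqrt_eq_rpow, ← Real.rpow_natCast (v ^ (4 / ((n : ℝ) - 2))), ← Real.rpow_mul hv.le,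
      ← Real.rpow_mul hv.le, ← Real.rpow_neg hv.le, ← Real.rpow_add hv, ← Real.rpow_natCast v 2]
    congr 1
    push_cast
    field_simp
    ring
  rw [← this]
  ring

theorem IsHarmonic.isInteriorHarmonic_mul (hn : 3 ≤ n) (hu : ∀ p, 0 < u p)
    (h : ∀ (p : M) (v w : TangentSpace (𝓡∂ n) p),
      g'.inner p v w = u p ^ (4 / ((n : ℝ) - 2)) * g.inner p v w)
    (huh : IsHarmonic g u) {f : M → ℝ} (hf : IsHarmonic g' f) :
    IsInteriorHarmonic g fun p => u p * f p := by
  refine ⟨huh.1.mul hf.1, fun e he x hx => ?_⟩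
  have hsymm : ∀ i j, laplaceCoeff (chartMetricCoeff g e) x i j
      = laplaceCoeff (chartMetricCoeff g e) x j i := fun i j => by
    simpa using (laplaceCoeff_posDef g he (interior_subset hx)).isHermitian.apply j i
  refine divergenceOp_mul_eq_zero (differentiableAt_laplaceCoeff g he hx) hsymm
    (contDiffAt_comp_extend_symm he huh.1 hx) (contDiffAt_comp_extend_symm he hf.1 hx)
    (hu _).ne' ?_ (huh.divergenceOp_eq_zero he hx)
  rw [← hf.divergenceOp_eq_zero he hx, divergenceOp]
  refine Finset.sum_congr rfl fun i _ => Finset.sum_congr rfl fun j _ => pderiv_congr ?_ i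
  filter_upwards [isOpen_interior.mem_nhds hx] with y hy
  rw [laplaceCoeff_conformal hn hu h he (interior_subset hy)]
  rfl

/-- Both sides are `g`-harmonic with the same boundary values and the same limit, so the comparison
principle applies in both directions. -/
theorem IsBoundaryPotential.eq_mul [T2Space M] [ConnectedSpace M]
    (hnonempty : ((𝓡∂ n).boundary M).Nonempty) (hn : 3 ≤ n) (hu : ∀ p, 0 < u p)
    (h : ∀ (p : M) (v w : TangentSpace (𝓡∂ n) p),
      g'.inner p v w = u p ^ (4 / ((n : ℝ) - 2)) * g.inner p v w)
    (huh : IsHarmonic g u) (hul : TendsToAtInfinity u 1) {φ φ' : M → ℝ}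
    (hφ : IsBoundaryPotential g φ) (hφ' : IsBoundaryPotential g' φ') (p : M) :
    φ p = u p * φ' p := by
  have h₁ := hφ.harmonic.isInteriorHarmonic
  have h₂ := huh.isInteriorHarmonic_mul hn hu h hφ'.harmonic
  have hl : TendsToAtInfinity (fun p => u p * φ' p) 1 := by
    have := Tendsto.mul hul hφ'.tendsto
    rwa [mul_one] at this
  have hb : ∀ p ∈ (𝓡∂ n).boundary M, φ p = u p * φ' p := fun p hp => by
    rw [hφ.eq_zero p hp, hφ'.eq_zero p hp, mul_zero]
  exact le_antisymm
    (h₁.le_of_le_boundary hnonempty h₂ (fun p hp => (hb p hp).le) hφ.tendsto hl le_rfl p)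
    (h₂.le_of_le_boundary hnonempty h₁ (fun p hp => (hb p hp).ge) hl hφ.tendsto le_rfl p)

theorem IsBoundaryPotential.nonneg [T2Space M] [ConnectedSpace M]
    (hnonempty : ((𝓡∂ n).boundary M).Nonempty) {φ : M → ℝ} (hφ : IsBoundaryPotential g φ) (p : M) :
    0 ≤ φ p :=
  (isInteriorHarmonic_zero g).le_of_le_boundary hnonempty hφ.harmonic.isInteriorHarmonic
    (fun p hp => (hφ.eq_zero p hp).ge) (c₁ := 0) tendsto_const_nhds hφ.tendsto zero_le_one p

end Conformal

/-! ### Densities and suprema of measures -/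

section WithDensity

variable {α : Type*} [MeasurableSpace α]

theorem withDensity_mono_left {μ ν : Measure α} (h : μ ≤ ν) (f : α → ENNReal) :
    μ.withDensity f ≤ ν.withDensity f := by
  refine Measure.le_iff.2 fun s hs => ?_
  rw [withDensity_apply _ hs, withDensity_apply _ hs]
  exact lintegral_mono' (Measure.restrict_mono subset_rfl h) le_rfl

theorem withDensity_withDensity_of_mul_eq_one (μ : Measure α) {f h : α → ENNReal}
    (hf : Measurable f) (hh : Measurable h) (hfh : ∀ x, f x * h x = 1) :
    (μ.withDensity f).withDensity h = μ := by
  rw [← withDensity_mul μ hf hh]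
  have : f * h = 1 := funext hfh
  rw [this, withDensity_one]

/-- Multiplication by an invertible density is an order automorphism of the measures, with inverse
given by `h`, and so it preserves suprema. -/
theorem iSup_withDensity {ι : Sort*} (μ : ι → Measure α) {f h : α → ENNReal}
    (hf : Measurable f) (hh : Measurable h) (hfh : ∀ x, f x * h x = 1) :
    ⨆ i, (μ i).withDensity f = (⨆ i, μ i).withDensity f := by
  refine le_antisymm (iSup_le fun i => withDensity_mono_left (le_iSup _ i) f) ?_
  rw [← withDensity_withDensity_of_mul_eq_one (⨆ i, (μ i).withDensity f) hh hf
    fun x => by rw [mul_comm, hfh]]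
  refine withDensity_mono_left (iSup_le fun i => ?_) f
  conv_lhs => rw [← withDensity_withDensity_of_mul_eq_one (μ i) hf hh hfh]
  exact withDensity_mono_left (le_iSup (fun i => (μ i).withDensity f) i) h

end WithDensity

/-! ### The boundary measure and its conformal change -/

section BoundaryMeasure

variable {n : ℕ} [NeZero n] {M : Type*} [TopologicalSpace M]
  [ChartedSpace (EuclideanHalfSpace n) M] [IsManifold (𝓡∂ n) ∞ M]
  {e e' : OpenPartialHomeomorph M (EuclideanHalfSpace n)} {g g' : SmoothMetric n M}

/-- The inclusion of the boundary hyperplane as a continuous linear map. -/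
def boundaryInclCLM (n : ℕ) [NeZero n] :
    ({i : Fin n // i ≠ 0} → ℝ) →L[ℝ] EuclideanSpace ℝ (Fin n) :=
  LinearMap.toContinuousLinearMap
    { toFun := boundaryIncl
      map_add' := fun x y => by
        ext i
        by_cases h : i = 0 <;> simp [boundaryIncl, h]
      map_smul' := fun c x => by
        ext i
        by_cases h : i = 0 <;> simp [boundaryIncl, h] }

theorem boundaryInclCLM_apply (y : {i : Fin n // i ≠ 0} → ℝ) :
    boundaryInclCLM n y = boundaryIncl y := rfl

theorem continuous_boundaryIncl : Continuous (boundaryIncl (n := n)) :=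
  (boundaryInclCLM n).continuous

theorem boundaryIncl_zero_coord (y : {i : Fin n // i ≠ 0} → ℝ) : boundaryIncl y 0 = 0 := by
  simp [boundaryIncl]

theorem boundaryIncl_coord (y : {i : Fin n // i ≠ 0} → ℝ) (i : {i : Fin n // i ≠ 0}) :
    boundaryIncl y i = y i := by
  simp [boundaryIncl, i.2]

theorem boundaryIncl_mem_range (y : {i : Fin n // i ≠ 0} → ℝ) :
    boundaryIncl y ∈ Set.range (𝓡∂ n) := by
  rw [range_modelWithCornersEuclideanHalfSpace]
  exact (boundaryIncl_zero_coord y).ge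

/-- The projection to the boundary hyperplane. -/
def boundaryProj (n : ℕ) [NeZero n] :
    EuclideanSpace ℝ (Fin n) →L[ℝ] ({i : Fin n // i ≠ 0} → ℝ) :=
  ContinuousLinearMap.pi fun i => EuclideanSpace.proj i.1

theorem boundaryIncl_boundaryProj {x : EuclideanSpace ℝ (Fin n)} (hx : x 0 = 0) :
    boundaryIncl (boundaryProj n x) = x := by
  ext i
  by_cases h : i = 0
  · subst h
    rw [boundaryIncl_zero_coord, hx]
  · exact boundaryIncl_coord _ ⟨i, h⟩

theorem boundaryProj_boundaryIncl (y : {i : Fin n // i ≠ 0} → ℝ) :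
    boundaryProj n (boundaryIncl y) = y :=
  funext fun i => boundaryIncl_coord y i

/-- The domain of the boundary coordinates of a chart. -/
def boundaryDomain (e : OpenPartialHomeomorph M (EuclideanHalfSpace n)) :
    Set ({i : Fin n // i ≠ 0} → ℝ) :=
  boundaryIncl ⁻¹' (e.extend (𝓡∂ n)).target

/-- The parametrization of the boundary by the boundary coordinates of a chart. -/
def boundaryParam (e : OpenPartialHomeomorph M (EuclideanHalfSpace n))
    (y : {i : Fin n // i ≠ 0} → ℝ) : M :=
  (e.extend (𝓡∂ n)).symm (boundaryIncl y)

/-- The coefficients of the metric induced on the boundary. -/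
def boundaryCoeff (g : SmoothMetric n M) (e : OpenPartialHomeomorph M (EuclideanHalfSpace n))
    (y : {i : Fin n // i ≠ 0} → ℝ) : Matrix {i : Fin n // i ≠ 0} {i : Fin n // i ≠ 0} ℝ :=
  (chartMetricCoeff g e (boundaryIncl y)).submatrix Subtype.val Subtype.val

/-- The area density of the boundary in the boundary coordinates of a chart. -/
def boundaryDensity (g : SmoothMetric n M) (e : OpenPartialHomeomorph M (EuclideanHalfSpace n))
    (y : {i : Fin n // i ≠ 0} → ℝ) : ENNReal :=
  ENNReal.ofReal √(boundaryCoeff g e y).det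

theorem chartBoundaryMeasure_eq [MeasurableSpace M] :
    chartBoundaryMeasure g e = ((volume.restrict (boundaryDomain e)).withDensity
      (boundaryDensity g e)).map (boundaryParam e) := rfl

theorem isOpen_boundaryDomain : IsOpen (boundaryDomain e) := by
  have : boundaryDomain e = (fun y => (𝓡∂ n).symm (boundaryIncl y)) ⁻¹' e.target := by
    ext y
    simp only [boundaryDomain, Set.mem_preimage, e.extend_target, Set.mem_inter_iff,
      boundaryIncl_mem_range, and_true]
  rw [this]
  exact e.open_target.preimage ((𝓡∂ n).continuous_symm.comp continuous_boundaryIncl)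

theorem continuousOn_boundaryParam : ContinuousOn (boundaryParam e) (boundaryDomain e) :=
  (e.continuousOn_extend_symm (I := 𝓡∂ n)).comp continuous_boundaryIncl.continuousOn fun _ hy => hy

theorem boundaryParam_mem_boundary (he : e ∈ IsManifold.maximalAtlas (𝓡∂ n) ∞ M)
    {y : {i : Fin n // i ≠ 0} → ℝ} (hy : y ∈ boundaryDomain e) :
    boundaryParam e y ∈ (𝓡∂ n).boundary M :=
  (extend_symm_mem_boundary_iff he hy).2 (boundaryIncl_zero_coord y)

theorem extend_boundaryParam {y : {i : Fin n // i ≠ 0} → ℝ} (hy : y ∈ boundaryDomain e) :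
    e.extend (𝓡∂ n) (boundaryParam e y) = boundaryIncl y :=
  (e.extend (𝓡∂ n)).right_inv hy

theorem boundaryProj_extend (he : e ∈ IsManifold.maximalAtlas (𝓡∂ n) ∞ M) {p : M}
    (hp : p ∈ e.source) (hpb : p ∈ (𝓡∂ n).boundary M) :
    boundaryProj n (e.extend (𝓡∂ n) p) ∈ boundaryDomain e ∧
      boundaryIncl (boundaryProj n (e.extend (𝓡∂ n) p)) = e.extend (𝓡∂ n) p ∧
      boundaryParam e (boundaryProj n (e.extend (𝓡∂ n) p)) = p := by
  have h := boundaryIncl_boundaryProj ((mem_boundary_iff_of_mem_maximalAtlas he hp).1 hpb)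
  refine ⟨?_, h, ?_⟩
  · rw [boundaryDomain, Set.mem_preimage, h]
    exact (e.extend (𝓡∂ n)).map_source (by rwa [e.extend_source])
  · rw [boundaryParam, h]
    exact e.extend_left_inv hp

theorem continuousOn_boundaryDensity (he : e ∈ IsManifold.maximalAtlas (𝓡∂ n) ∞ M) :
    ContinuousOn (boundaryDensity g e) (boundaryDomain e) := by
  refine ENNReal.continuous_ofReal.comp_continuousOn (Real.continuous_sqrt.comp_continuousOn ?_)
  have h : ∀ i j, ContinuousOn (fun y => boundaryCoeff g e y i j) (boundaryDomain e) :=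
    fun i j => (contDiffOn_chartMetricCoeff g he i j).continuousOn.comp
      continuous_boundaryIncl.continuousOn fun _ hy => hy
  have h2 : ContinuousOn (boundaryCoeff g e) (boundaryDomain e) :=
    continuousOn_pi.2 fun i => continuousOn_pi.2 fun j => h i j
  exact (Continuous.matrix_det continuous_id).comp_continuousOn h2

variable [MeasurableSpace M] [BorelSpace M]

theorem lintegral_chartBoundaryMeasure (he : e ∈ IsManifold.maximalAtlas (𝓡∂ n) ∞ M)
    {f : M → ENNReal} (hf : Measurable f) :
    ∫⁻ p, f p ∂(chartBoundaryMeasure g e)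
      = ∫⁻ y in boundaryDomain e, boundaryDensity g e y * f (boundaryParam e y) := by
  have hY : MeasurableSet (boundaryDomain e) := isOpen_boundaryDomain.measurableSet
  have hP : AEMeasurable (boundaryParam e) (volume.restrict (boundaryDomain e)) :=
    continuousOn_boundaryParam.aemeasurable hY
  have hw : AEMeasurable (boundaryDensity g e) (volume.restrict (boundaryDomain e)) :=
    (continuousOn_boundaryDensity he).aemeasurable hY
  have hac := withDensity_absolutelyContinuous (volume.restrict (boundaryDomain e))
    (boundaryDensity g e)
  rw [chartBoundaryMeasure_eq, lintegral_map' hf.aemeasurable (hP.mono_ac hac),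
    lintegral_withDensity_eq_lintegral_mul₀ hw (g := fun y => f (boundaryParam e y))
      (hf.comp_aemeasurable hP)]
  rfl

theorem measurableSet_boundaryDomain_inter {A : Set M} (hA : MeasurableSet A) :
    MeasurableSet (boundaryDomain e ∩ boundaryParam e ⁻¹' A) := by
  have h := (continuousOn_boundaryParam (e := e)).domRestrict.measurable hA
  have hY : MeasurableSet (boundaryDomain e) := isOpen_boundaryDomain.measurableSet
  have := hY.subtype_image h
  rwa [show (boundaryDomain e).domRestrict (boundaryParam e) ⁻¹' A
    = Subtype.val ⁻¹' (boundaryParam e ⁻¹' A) from rfl, Subtype.image_preimage_coe] at this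

theorem chartBoundaryMeasure_apply (he : e ∈ IsManifold.maximalAtlas (𝓡∂ n) ∞ M)
    {A : Set M} (hA : MeasurableSet A) :
    chartBoundaryMeasure g e A
      = ∫⁻ y in boundaryDomain e ∩ boundaryParam e ⁻¹' A, boundaryDensity g e y := by
  have hZ := measurableSet_boundaryDomain_inter (e := e) hA
  rw [← lintegral_indicator_one hA, lintegral_chartBoundaryMeasure he (measurable_one.indicator hA),
    ← lintegral_indicator hZ, ← lintegral_indicator isOpen_boundaryDomain.measurableSet]
  refine lintegral_congr fun y => ?_
  by_cases hy : y ∈ boundaryDomain e <;> by_cases hyA : boundaryParam e y ∈ A <;>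
    simp [Set.indicator, hy, hyA]

theorem chartBoundaryMeasure_compl_boundary (he : e ∈ IsManifold.maximalAtlas (𝓡∂ n) ∞ M) :
    chartBoundaryMeasure g e ((𝓡∂ n).boundary M)ᶜ = 0 := by
  have hm : MeasurableSet ((𝓡∂ n).boundary M) :=
    (ModelWithCorners.isClosed_boundary (n := ∞) (by simp)).measurableSet
  rw [chartBoundaryMeasure_apply he hm.compl]
  have : boundaryDomain e ∩ boundaryParam e ⁻¹' ((𝓡∂ n).boundary M)ᶜ = ∅ := by
    ext y
    simp only [Set.mem_inter_iff, Set.mem_preimage, Set.mem_compl_iff, Set.mem_empty_iff_false,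
      iff_false, not_and, not_not]
    exact boundaryParam_mem_boundary he
  rw [this, Measure.restrict_empty, lintegral_zero_measure]

/-- A supremum of measures is not computed setwise. Instead, the restriction of the measure to the
boundary is shown to be an upper bound of all chart measures, so it dominates their supremum. -/
theorem boundaryMeasure_compl_boundary :
    boundaryMeasure g ((𝓡∂ n).boundary M)ᶜ = 0 := by
  have hm : MeasurableSet ((𝓡∂ n).boundary M) :=
    (ModelWithCorners.isClosed_boundary (n := ∞) (by simp)).measurableSet
  have h : boundaryMeasure g ≤ (boundaryMeasure g).restrict ((𝓡∂ n).boundary M) := by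
    conv_lhs => rw [boundaryMeasure]
    refine iSup₂_le fun e he => ?_
    rw [← Measure.restrict_eq_self_of_ae_mem (μ := chartBoundaryMeasure g e)
      (s := (𝓡∂ n).boundary M) (chartBoundaryMeasure_compl_boundary he)]
    exact Measure.restrict_mono subset_rfl
      (le_iSup₂ (f := fun e (_ : e ∈ IsManifold.maximalAtlas (𝓡∂ n) ∞ M) =>
        chartBoundaryMeasure g e) e he)
  refine le_antisymm ((h _).trans_eq ?_) zero_le
  rw [Measure.restrict_apply hm.compl]
  simp

theorem boundaryMeasure_restrict_boundary :
    (boundaryMeasure g).restrict ((𝓡∂ n).boundary M) = boundaryMeasure g :=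
  Measure.restrict_eq_self_of_ae_mem boundaryMeasure_compl_boundary

/-- The Gram determinant of the boundary has size `n - 1`, so it scales by `a ^ (n - 1)`. -/
theorem chartBoundaryMeasure_conformal {a : M → ℝ} (ha : ∀ p, 0 < a p) (hac : Continuous a)
    (h : ∀ (p : M) (v w : TangentSpace (𝓡∂ n) p), g'.inner p v w = a p * g.inner p v w)
    (he : e ∈ IsManifold.maximalAtlas (𝓡∂ n) ∞ M) :
    chartBoundaryMeasure g' e = (chartBoundaryMeasure g e).withDensity
      fun p => ENNReal.ofReal √(a p ^ (n - 1)) := by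
  have hρ : Measurable fun p => ENNReal.ofReal √(a p ^ (n - 1)) :=
    ((hac.pow _).sqrt.measurable).ennreal_ofReal
  have hw : ∀ y, boundaryDensity g' e y
      = boundaryDensity g e y * ENNReal.ofReal √(a (boundaryParam e y) ^ (n - 1)) := fun y => by
    have hcard : Fintype.card {i : Fin n // i ≠ 0} = n - 1 := by simp
    rw [boundaryDensity, boundaryDensity, ← ENNReal.ofReal_mul (Real.sqrt_nonneg _), mul_comm,
      ← Real.sqrt_mul (pow_nonneg (ha _).le _), ← hcard, ← Matrix.det_smul, boundaryCoeff,
      boundaryCoeff, chartMetricCoeff_conformal h, Matrix.submatrix_smul]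
    rfl
  refine Measure.ext fun A hA => ?_
  rw [withDensity_apply _ hA, ← lintegral_indicator hA,
    lintegral_chartBoundaryMeasure he (hρ.indicator hA), ← lintegral_indicator_one hA,
    lintegral_chartBoundaryMeasure he (measurable_one.indicator hA)]
  refine lintegral_congr fun y => ?_
  rw [hw]
  by_cases hyA : boundaryParam e y ∈ A <;> simp [Set.indicator, hyA]

theorem boundaryMeasure_conformal {a : M → ℝ} (ha : ∀ p, 0 < a p) (hac : Continuous a)
    (h : ∀ (p : M) (v w : TangentSpace (𝓡∂ n) p), g'.inner p v w = a p * g.inner p v w) :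
    boundaryMeasure g' = (boundaryMeasure g).withDensity
      fun p => ENNReal.ofReal √(a p ^ (n - 1)) := by
  have hpos : ∀ p, 0 < √(a p ^ (n - 1)) := fun p => Real.sqrt_pos.2 (pow_pos (ha p) _)
  have hρ : Measurable fun p => ENNReal.ofReal √(a p ^ (n - 1)) :=
    ((hac.pow _).sqrt.measurable).ennreal_ofReal
  have hmul : ∀ p, ENNReal.ofReal √(a p ^ (n - 1)) * (ENNReal.ofReal √(a p ^ (n - 1)))⁻¹ = 1 :=
    fun p => ENNReal.mul_inv_cancel (ENNReal.ofReal_pos.2 (hpos p)).ne' ENNReal.ofReal_ne_top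
  rw [boundaryMeasure, boundaryMeasure, iSup_subtype', iSup_subtype',
    ← iSup_withDensity _ hρ hρ.inv hmul]
  exact iSup_congr fun e => chartBoundaryMeasure_conformal ha hac h e.2

end BoundaryMeasure

/-! ### Change of charts on the boundary, and finiteness of the area -/

section BoundaryTransition

variable {n : ℕ} [NeZero n] {M : Type*} [TopologicalSpace M]
  [ChartedSpace (EuclideanHalfSpace n) M] [IsManifold (𝓡∂ n) ∞ M]
  {e e' : OpenPartialHomeomorph M (EuclideanHalfSpace n)} {g : SmoothMetric n M}

/-- The differential of the transition map from the chart `e` to the chart `e'`. -/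
def transitionDeriv (e e' : OpenPartialHomeomorph M (EuclideanHalfSpace n))
    (x : EuclideanSpace ℝ (Fin n)) : EuclideanSpace ℝ (Fin n) →L[ℝ] EuclideanSpace ℝ (Fin n) :=
  fderivWithin ℝ (e'.extend (𝓡∂ n) ∘ (e.extend (𝓡∂ n)).symm) (Set.range (𝓡∂ n)) x

theorem differentiableWithinAt_transition (he : e ∈ IsManifold.maximalAtlas (𝓡∂ n) ∞ M)
    (he' : e' ∈ IsManifold.maximalAtlas (𝓡∂ n) ∞ M) {x : EuclideanSpace ℝ (Fin n)}
    (hx : x ∈ (e.extend (𝓡∂ n)).target) (hx' : (e.extend (𝓡∂ n)).symm x ∈ e'.source) :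
    DifferentiableWithinAt ℝ (e'.extend (𝓡∂ n) ∘ (e.extend (𝓡∂ n)).symm)
      (Set.range (𝓡∂ n)) x :=
  (MDifferentiableAt.comp_mdifferentiableWithinAt x
    ((e'.contMDiffAt_extend he' hx').mdifferentiableAt (by simp))
    (mdifferentiableWithinAt_extend_symm he hx)).differentiableWithinAt

/-- Tangent spaces at equal but not syntactically identical points are different types; both unfold
to Euclidean space, where vectors can be compared. -/
theorem SmoothMetric.inner_congr (g : SmoothMetric n M) {p q : M} (h : p = q)
    {v v' w w' : EuclideanSpace ℝ (Fin n)} (hv : v = v') (hw : w = w') :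
    g.inner p (show TangentSpace (𝓡∂ n) p from v) (show TangentSpace (𝓡∂ n) p from w)
      = g.inner q (show TangentSpace (𝓡∂ n) q from v') (show TangentSpace (𝓡∂ n) q from w') := by
  subst h hv hw
  rfl

theorem chartFrame_transitionDeriv (he : e ∈ IsManifold.maximalAtlas (𝓡∂ n) ∞ M)
    (he' : e' ∈ IsManifold.maximalAtlas (𝓡∂ n) ∞ M) {x : EuclideanSpace ℝ (Fin n)}
    (hx : x ∈ (e.extend (𝓡∂ n)).target) (hx' : (e.extend (𝓡∂ n)).symm x ∈ e'.source)
    (v : EuclideanSpace ℝ (Fin n)) :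
    (show EuclideanSpace ℝ (Fin n) from
      chartFrame e' (e'.extend (𝓡∂ n) ((e.extend (𝓡∂ n)).symm x)) (transitionDeriv e e' x v))
      = (show EuclideanSpace ℝ (Fin n) from chartFrame e x v) := by
  have hu : UniqueDiffWithinAt ℝ (Set.range (𝓡∂ n)) x :=
    (𝓡∂ n).uniqueDiffOn x (e.extend_target_subset_range (I := 𝓡∂ n) hx)
  have hT : e'.extend (𝓡∂ n) ((e.extend (𝓡∂ n)).symm x) ∈ (e'.extend (𝓡∂ n)).target :=
    (e'.extend (𝓡∂ n)).map_source (by rwa [e'.extend_source])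
  have h1 := mfderivWithin_comp x (mdifferentiableWithinAt_extend_symm he' hT)
    (differentiableWithinAt_transition he he' hx hx').mdifferentiableWithinAt
    (fun y _ => ⟨e' ((e.extend (𝓡∂ n)).symm y), rfl⟩) hu.uniqueMDiffWithinAt
  have hc : ContinuousWithinAt (e.extend (𝓡∂ n)).symm (Set.range (𝓡∂ n)) x :=
    (mdifferentiableWithinAt_extend_symm he hx).continuousWithinAt
  have h2 : ((e'.extend (𝓡∂ n)).symm ∘ (e'.extend (𝓡∂ n) ∘ (e.extend (𝓡∂ n)).symm))
      =ᶠ[𝓝[Set.range (𝓡∂ n)] x] (e.extend (𝓡∂ n)).symm := by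
    filter_upwards [hc.tendsto.eventually (e'.open_source.mem_nhds hx')] with y hy
    exact e'.extend_left_inv hy
  have h3 := h2.mfderivWithin_eq (I := 𝓘(ℝ, EuclideanSpace ℝ (Fin n))) (I' := 𝓡∂ n)
    (e'.extend_left_inv hx')
  have h4 := h1.symm.trans h3
  rw [mfderivWithin_eq_fderivWithin] at h4
  exact DFunLike.congr_fun h4 v

theorem inner_transitionDeriv (he : e ∈ IsManifold.maximalAtlas (𝓡∂ n) ∞ M)
    (he' : e' ∈ IsManifold.maximalAtlas (𝓡∂ n) ∞ M) {x : EuclideanSpace ℝ (Fin n)}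
    (hx : x ∈ (e.extend (𝓡∂ n)).target) (hx' : (e.extend (𝓡∂ n)).symm x ∈ e'.source)
    (v w : EuclideanSpace ℝ (Fin n)) :
    g.inner _ (chartFrame e' (e'.extend (𝓡∂ n) ((e.extend (𝓡∂ n)).symm x))
        (transitionDeriv e e' x v))
      (chartFrame e' (e'.extend (𝓡∂ n) ((e.extend (𝓡∂ n)).symm x)) (transitionDeriv e e' x w))
      = g.inner _ (chartFrame e x v) (chartFrame e x w) :=
  g.inner_congr (e'.extend_left_inv hx') (chartFrame_transitionDeriv he he' hx hx' v)
    (chartFrame_transitionDeriv he he' hx hx' w)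

theorem boundaryIncl_single (i : {i : Fin n // i ≠ 0}) :
    boundaryIncl (Pi.single i (1 : ℝ)) = EuclideanSpace.single i.1 (1 : ℝ) := by
  ext j
  by_cases h : j = 0
  · subst h
    rw [boundaryIncl_zero_coord]
    simp [i.2.symm]
  · rw [show j = (⟨j, h⟩ : {i : Fin n // i ≠ 0}).1 from rfl, boundaryIncl_coord]
    simp [Pi.single_apply, Subtype.ext_iff]

theorem inner_chartFrame_boundaryIncl (g : SmoothMetric n M) (y a b : {i : Fin n // i ≠ 0} → ℝ) :
    g.inner _ (chartFrame e (boundaryIncl y) (boundaryIncl a))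
        (chartFrame e (boundaryIncl y) (boundaryIncl b))
      = ∑ i, ∑ j, a i * boundaryCoeff g e y i j * b j := by
  have h : ∀ a : {i : Fin n // i ≠ 0} → ℝ,
      boundaryIncl a = ∑ i, a i • EuclideanSpace.single i.1 (1 : ℝ) := fun a => by
    conv_lhs => rw [pi_eq_sum_univ' a, ← boundaryInclCLM_apply, map_sum]
    refine Finset.sum_congr rfl fun i _ => ?_
    rw [map_smul, boundaryInclCLM_apply, ← boundaryIncl_single]
  rw [h a, h b]
  simp only [map_sum, map_smul, FunLike.coe_sum, Finset.sum_apply, FunLike.coe_smul,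
    Pi.smul_apply, smul_eq_mul, boundaryCoeff, Matrix.submatrix_apply, chartMetricCoeff_apply,
    Finset.mul_sum]
  rw [Finset.sum_comm]
  exact Finset.sum_congr rfl fun i _ => Finset.sum_congr rfl fun j _ => by ring

theorem hasFDerivAt_extend_boundaryParam (he : e ∈ IsManifold.maximalAtlas (𝓡∂ n) ∞ M)
    (he' : e' ∈ IsManifold.maximalAtlas (𝓡∂ n) ∞ M) {y : {i : Fin n // i ≠ 0} → ℝ}
    (hy : y ∈ boundaryDomain e) (hy' : boundaryParam e y ∈ e'.source) :
    HasFDerivAt (fun y => e'.extend (𝓡∂ n) (boundaryParam e y))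
      (transitionDeriv e e' (boundaryIncl y) ∘L boundaryInclCLM n) y := by
  have h := (differentiableWithinAt_transition he he' hy hy').hasFDerivWithinAt
  rw [← hasFDerivWithinAt_univ]
  exact HasFDerivWithinAt.comp y (f := boundaryInclCLM n) h
    (boundaryInclCLM n).hasFDerivAt.hasFDerivWithinAt fun z _ => boundaryIncl_mem_range z

/-- Transition maps send boundary points to boundary points, so their zeroth coordinate is constant
along the hyperplane. -/
theorem transitionDeriv_boundaryIncl_zero (he : e ∈ IsManifold.maximalAtlas (𝓡∂ n) ∞ M)
    (he' : e' ∈ IsManifold.maximalAtlas (𝓡∂ n) ∞ M) {y : {i : Fin n // i ≠ 0} → ℝ}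
    (hy : y ∈ boundaryDomain e) (hy' : boundaryParam e y ∈ e'.source)
    (a : {i : Fin n // i ≠ 0} → ℝ) :
    transitionDeriv e e' (boundaryIncl y) (boundaryIncl a) 0 = 0 := by
  have h1 := (EuclideanSpace.proj (𝕜 := ℝ) (0 : Fin n)).hasFDerivAt.comp y
    (hasFDerivAt_extend_boundaryParam he he' hy hy')
  have hc : ContinuousAt (boundaryParam e) y :=
    continuousOn_boundaryParam.continuousAt (isOpen_boundaryDomain.mem_nhds hy)
  have h2 : (EuclideanSpace.proj (𝕜 := ℝ) (0 : Fin n)) ∘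
      (fun y => e'.extend (𝓡∂ n) (boundaryParam e y)) =ᶠ[𝓝 y] fun _ => (0 : ℝ) := by
    filter_upwards [isOpen_boundaryDomain.mem_nhds hy,
      hc.tendsto.eventually (e'.open_source.mem_nhds hy')] with z hz hz'
    exact (mem_boundary_iff_of_mem_maximalAtlas he' hz').1 (boundaryParam_mem_boundary he hz)
  have h3 := (h1.congr_of_eventuallyEq h2.symm).unique (hasFDerivAt_const (0 : ℝ) y)
  exact DFunLike.congr_fun h3 a

/-- The differential of the boundary transition map from the chart `e` to the chart `e'`. -/
def boundaryTransitionDeriv (e e' : OpenPartialHomeomorph M (EuclideanHalfSpace n))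
    (y : {i : Fin n // i ≠ 0} → ℝ) :
    ({i : Fin n // i ≠ 0} → ℝ) →L[ℝ] ({i : Fin n // i ≠ 0} → ℝ) :=
  boundaryProj n ∘L transitionDeriv e e' (boundaryIncl y) ∘L boundaryInclCLM n

/-- The transition differential preserves the hyperplane, so the full transformation law of the
metric restricts to the tangential block. -/
theorem boundaryCoeff_transition (he : e ∈ IsManifold.maximalAtlas (𝓡∂ n) ∞ M)
    (he' : e' ∈ IsManifold.maximalAtlas (𝓡∂ n) ∞ M) {y : {i : Fin n // i ≠ 0} → ℝ}
    (hy : y ∈ boundaryDomain e) (hy' : boundaryParam e y ∈ e'.source) :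
    boundaryCoeff g e y =
      (LinearMap.toMatrix' (boundaryTransitionDeriv e e' y).toLinearMap).transpose *
        boundaryCoeff g e' (boundaryProj n (e'.extend (𝓡∂ n) (boundaryParam e y))) *
        LinearMap.toMatrix' (boundaryTransitionDeriv e e' y).toLinearMap := by
  have hincl := (boundaryProj_extend he' hy' (boundaryParam_mem_boundary he hy)).2.1
  set y' := boundaryProj n (e'.extend (𝓡∂ n) (boundaryParam e y)) with hy'def
  have hL : ∀ a, transitionDeriv e e' (boundaryIncl y) (boundaryIncl a)
      = boundaryIncl (boundaryTransitionDeriv e e' y a) := fun a =>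
    (boundaryIncl_boundaryProj (transitionDeriv_boundaryIncl_zero he he' hy hy' a)).symm
  ext i j
  have h := inner_transitionDeriv (g := g) he he' hy hy' (boundaryIncl (Pi.single i 1))
    (boundaryIncl (Pi.single j 1))
  rw [hL, hL, show e'.extend (𝓡∂ n) ((e.extend (𝓡∂ n)).symm (boundaryIncl y)) = boundaryIncl y'
    from hincl.symm, inner_chartFrame_boundaryIncl] at h
  have h2 : boundaryCoeff g e y i j = g.inner _
      (chartFrame e (boundaryIncl y) (boundaryIncl (Pi.single i 1)))
      (chartFrame e (boundaryIncl y) (boundaryIncl (Pi.single j 1))) := by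
    rw [boundaryIncl_single, boundaryIncl_single]
    rfl
  rw [h2, ← h]
  simp only [Matrix.mul_apply, Matrix.transpose_apply, LinearMap.toMatrix'_apply,
    Finset.sum_mul, ContinuousLinearMap.coe_coe]
  exact Finset.sum_comm

theorem boundaryDensity_transition (he : e ∈ IsManifold.maximalAtlas (𝓡∂ n) ∞ M)
    (he' : e' ∈ IsManifold.maximalAtlas (𝓡∂ n) ∞ M) {y : {i : Fin n // i ≠ 0} → ℝ}
    (hy : y ∈ boundaryDomain e) (hy' : boundaryParam e y ∈ e'.source) :
    boundaryDensity g e y = ENNReal.ofReal |(boundaryTransitionDeriv e e' y).det| *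
      boundaryDensity g e' (boundaryProj n (e'.extend (𝓡∂ n) (boundaryParam e y))) := by
  rw [boundaryDensity, boundaryDensity, ← ENNReal.ofReal_mul (abs_nonneg _),
    boundaryCoeff_transition he he' hy hy', Matrix.det_mul, Matrix.det_mul, Matrix.det_transpose,
    LinearMap.det_toMatrix', mul_right_comm, ← pow_two, Real.sqrt_mul (sq_nonneg _),
    Real.sqrt_sq_eq_abs]

variable [MeasurableSpace M] [BorelSpace M]

/-- Inside the domain of the chart `e'`, the boundary measure of any chart is at most that of
`e'`. -/
theorem chartBoundaryMeasure_le (he : e ∈ IsManifold.maximalAtlas (𝓡∂ n) ∞ M)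
    (he' : e' ∈ IsManifold.maximalAtlas (𝓡∂ n) ∞ M) {A : Set M} (hA : MeasurableSet A)
    (hAe' : A ⊆ e'.source) : chartBoundaryMeasure g e A ≤ chartBoundaryMeasure g e' A := by
  rw [chartBoundaryMeasure_apply he hA, chartBoundaryMeasure_apply he' hA]
  set Z := boundaryDomain e ∩ boundaryParam e ⁻¹' A with hZdef
  set τ : ({i : Fin n // i ≠ 0} → ℝ) → ({i : Fin n // i ≠ 0} → ℝ) := fun y =>
    boundaryProj n (e'.extend (𝓡∂ n) (boundaryParam e y)) with hτ
  have hZ : MeasurableSet Z := measurableSet_boundaryDomain_inter hA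
  have hτp : ∀ y ∈ Z, τ y ∈ boundaryDomain e' ∧ boundaryParam e' (τ y) = boundaryParam e y :=
    fun y hy =>
      have := boundaryProj_extend he' (hAe' hy.2) (boundaryParam_mem_boundary he hy.1)
      ⟨this.1, this.2.2⟩
  have hderiv : ∀ y ∈ Z, HasFDerivWithinAt τ (boundaryTransitionDeriv e e' y) Z y := fun y hy =>
    ((boundaryProj n).hasFDerivAt.comp y
      (hasFDerivAt_extend_boundaryParam he he' hy.1 (hAe' hy.2))).hasFDerivWithinAt
  -- The boundary coordinates of both charts determine the point of `M`.
  have hinj : Set.InjOn τ Z := fun y hy z hz hyz => by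
    have h : boundaryParam e y = boundaryParam e z := by
      rw [← (hτp y hy).2, hyz, (hτp z hz).2]
    rw [← boundaryProj_boundaryIncl y, ← boundaryProj_boundaryIncl z, ← extend_boundaryParam hy.1,
      ← extend_boundaryParam hz.1, h]
  calc ∫⁻ y in Z, boundaryDensity g e y
      = ∫⁻ y in Z, ENNReal.ofReal |(boundaryTransitionDeriv e e' y).det| *
          boundaryDensity g e' (τ y) :=
        setLIntegral_congr_fun hZ fun y hy => boundaryDensity_transition he he' hy.1 (hAe' hy.2)
    _ = ∫⁻ y in τ '' Z, boundaryDensity g e' y :=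
        (lintegral_image_eq_lintegral_abs_det_fderiv_mul volume hZ hderiv hinj _).symm
    _ ≤ ∫⁻ y in boundaryDomain e' ∩ boundaryParam e' ⁻¹' A, boundaryDensity g e' y := by
        refine lintegral_mono_set ?_
        rintro _ ⟨y, hy, rfl⟩
        refine ⟨(hτp y hy).1, ?_⟩
        rw [Set.mem_preimage, (hτp y hy).2]
        exact hy.2

theorem exists_nhds_chartBoundaryMeasure_lt_top (g : SmoothMetric n M)
    (he : e ∈ IsManifold.maximalAtlas (𝓡∂ n) ∞ M) {p : M} (hp : p ∈ e.source)
    (hpb : p ∈ (𝓡∂ n).boundary M) :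
    ∃ V, IsOpen V ∧ p ∈ V ∧ V ⊆ e.source ∧ chartBoundaryMeasure g e V < ⊤ := by
  set y₀ := boundaryProj n (e.extend (𝓡∂ n) p) with hy₀
  have hy₀mem : y₀ ∈ boundaryDomain e := (boundaryProj_extend he hp hpb).1
  have hcont : ContinuousAt (boundaryDensity g e) y₀ :=
    (continuousOn_boundaryDensity he).continuousAt (isOpen_boundaryDomain.mem_nhds hy₀mem)
  have hlt : boundaryDensity g e y₀ < boundaryDensity g e y₀ + 1 :=
    ENNReal.lt_add_right ENNReal.ofReal_ne_top one_ne_zero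
  obtain ⟨r, hr, hball⟩ := Metric.eventually_nhds_iff_ball.1 (hcont.eventually_lt_const hlt)
  set V := e.source ∩ (fun q => boundaryProj n (e.extend (𝓡∂ n) q)) ⁻¹' Metric.ball y₀ r with hV
  have hVo : IsOpen V := by
    refine ContinuousOn.isOpen_inter_preimage ?_ e.open_source Metric.isOpen_ball
    refine (boundaryProj n).continuous.comp_continuousOn ?_
    have := e.continuousOn_extend (I := 𝓡∂ n)
    rwa [e.extend_source] at this
  refine ⟨V, hVo, ⟨hp, Metric.mem_ball_self hr⟩, Set.inter_subset_left, ?_⟩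
  rw [chartBoundaryMeasure_apply he hVo.measurableSet]
  have hsub : boundaryDomain e ∩ boundaryParam e ⁻¹' V ⊆ Metric.ball y₀ r := fun y hy => by
    have := hy.2.2
    rwa [Set.mem_preimage, extend_boundaryParam hy.1, boundaryProj_boundaryIncl] at this
  calc ∫⁻ y in boundaryDomain e ∩ boundaryParam e ⁻¹' V, boundaryDensity g e y
      ≤ ∫⁻ y in Metric.ball y₀ r, boundaryDensity g e y := lintegral_mono_set hsub
    _ ≤ ∫⁻ _ in Metric.ball y₀ r, (boundaryDensity g e y₀ + 1) :=
        setLIntegral_mono measurable_const fun y hy => (hball y hy).le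
    _ = (boundaryDensity g e y₀ + 1) * volume (Metric.ball y₀ r) := setLIntegral_const _ _
    _ < ⊤ := ENNReal.mul_lt_top (ENNReal.add_lt_top.2 ⟨ENNReal.ofReal_lt_top, ENNReal.one_lt_top⟩)
        measure_ball_lt_top

/-- Cover the boundary by finitely many open sets, each of finite mass in its own chart. Any chart
measure is bounded by the sum of these fixed pieces, hence so is the supremum. -/
theorem isFiniteMeasure_boundaryMeasure (hcompact : IsCompact ((𝓡∂ n).boundary M))
    (g : SmoothMetric n M) : IsFiniteMeasure (boundaryMeasure g) := by
  have hmax : ∀ p : M, chartAt (EuclideanHalfSpace n) p ∈ IsManifold.maximalAtlas (𝓡∂ n) ∞ M :=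
    fun p => IsManifold.chart_mem_maximalAtlas p
  have hbm : MeasurableSet ((𝓡∂ n).boundary M) :=
    (ModelWithCorners.isClosed_boundary (n := ∞) (by simp)).measurableSet
  choose! V hVo hpV hVs hVfin using fun (p : M) (hp : p ∈ (𝓡∂ n).boundary M) =>
    exists_nhds_chartBoundaryMeasure_lt_top g (hmax p)
      (mem_chart_source (EuclideanHalfSpace n) p) hp
  obtain ⟨t, ht, hcover⟩ := hcompact.elim_nhds_subcover V
    fun p hp => (hVo p hp).mem_nhds (hpV p hp)
  have hle : boundaryMeasure g ≤ ∑ p ∈ t,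
      (chartBoundaryMeasure g (chartAt (EuclideanHalfSpace n) p)).restrict (V p) := by
    refine iSup₂_le fun e he => Measure.le_iff.2 fun A hA => ?_
    have h1 : A ⊆ ((𝓡∂ n).boundary M)ᶜ ∪ ⋃ p ∈ t, A ∩ V p := fun q hq => by
      by_cases hqb : q ∈ (𝓡∂ n).boundary M
      · obtain ⟨p, hp, hqV⟩ := Set.mem_iUnion₂.1 (hcover hqb)
        exact Or.inr (Set.mem_iUnion₂.2 ⟨p, hp, hq, hqV⟩)
      · exact Or.inl hqb
    calc chartBoundaryMeasure g e A
        ≤ chartBoundaryMeasure g e ((𝓡∂ n).boundary M)ᶜ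
          + chartBoundaryMeasure g e (⋃ p ∈ t, A ∩ V p) :=
          (measure_mono h1).trans (measure_union_le _ _)
      _ = chartBoundaryMeasure g e (⋃ p ∈ t, A ∩ V p) := by
          rw [chartBoundaryMeasure_compl_boundary he, zero_add]
      _ ≤ ∑ p ∈ t, chartBoundaryMeasure g e (A ∩ V p) := measure_biUnion_finset_le _ _
      _ ≤ ∑ p ∈ t, chartBoundaryMeasure g (chartAt (EuclideanHalfSpace n) p) (A ∩ V p) :=
          Finset.sum_le_sum fun p hp => chartBoundaryMeasure_le he (hmax p)
            (hA.inter (hVo p (ht p hp)).measurableSet)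
            (Set.inter_subset_right.trans (hVs p (ht p hp)))
      _ = (∑ p ∈ t, (chartBoundaryMeasure g (chartAt (EuclideanHalfSpace n) p)).restrict (V p)) A := by
          rw [Measure.finsetSum_apply]
          exact Finset.sum_congr rfl fun p hp => (Measure.restrict_apply hA).symm
  refine ⟨(hle _).trans_lt ?_⟩
  rw [Measure.finsetSum_apply]
  refine ENNReal.sum_lt_top.2 fun p hp => ?_
  rw [Measure.restrict_apply_univ]
  exact hVfin p (ht p hp)

end BoundaryTransition

/-! ### The normal derivative: sign, continuity, conformal change -/

section NormalDerivative

variable {n : ℕ} [NeZero n] {M : Type*} [TopologicalSpace M]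
  [ChartedSpace (EuclideanHalfSpace n) M] [IsManifold (𝓡∂ n) ∞ M]
  {e : OpenPartialHomeomorph M (EuclideanHalfSpace n)} {g g' : SmoothMetric n M} {f : M → ℝ}
  {p : M}

theorem isInwardUnitNormal_inwardUnitNormal (g : SmoothMetric n M) (p : M) :
    IsInwardUnitNormal g p (inwardUnitNormal g p) :=
  Classical.choose_spec (exists_isInwardUnitNormal g p)

/-- The preferred chart at `p` trivializes the tangent space at `p`, so its differential there is
the identity. -/
theorem normalCovector_apply (p : M) (v : EuclideanSpace ℝ (Fin n)) :
    normalCovector p (show TangentSpace (𝓡∂ n) p from v) = v 0 := by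
  simp only [normalCovector, mfderiv_extChartAt_self]
  rfl

theorem mfderiv_apply_eq_fderivWithin (hf : ContMDiff (𝓡∂ n) 𝓘(ℝ, ℝ) ∞ f)
    (v : EuclideanSpace ℝ (Fin n)) :
    mfderiv (𝓡∂ n) 𝓘(ℝ, ℝ) f p (show TangentSpace (𝓡∂ n) p from v)
      = fderivWithin ℝ (f ∘ ((chartAt (EuclideanHalfSpace n) p).extend (𝓡∂ n)).symm)
        (Set.range (𝓡∂ n)) ((chartAt (EuclideanHalfSpace n) p).extend (𝓡∂ n) p) v := by
  rw [MDifferentiableAt.mfderiv (hf.mdifferentiableAt (by simp))]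
  rfl

theorem differentiableWithinAt_comp_extend_symm (he : e ∈ IsManifold.maximalAtlas (𝓡∂ n) ∞ M)
    (hf : ContMDiff (𝓡∂ n) 𝓘(ℝ, ℝ) ∞ f) {x : EuclideanSpace ℝ (Fin n)}
    (hx : x ∈ (e.extend (𝓡∂ n)).target) :
    DifferentiableWithinAt ℝ (f ∘ (e.extend (𝓡∂ n)).symm) (Set.range (𝓡∂ n)) x :=
  ((contDiffOn_comp_extend_symm he hf x hx).differentiableWithinAt (by simp)).mono_of_mem_nhdsWithin
    (extend_target_mem_nhdsWithin_range hx)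

theorem fderivWithin_boundaryIncl_eq_zero (he : e ∈ IsManifold.maximalAtlas (𝓡∂ n) ∞ M)
    (hf : ContMDiff (𝓡∂ n) 𝓘(ℝ, ℝ) ∞ f) (h0 : ∀ q ∈ (𝓡∂ n).boundary M, f q = 0)
    {y : {i : Fin n // i ≠ 0} → ℝ} (hy : y ∈ boundaryDomain e) (a : {i : Fin n // i ≠ 0} → ℝ) :
    fderivWithin ℝ (f ∘ (e.extend (𝓡∂ n)).symm) (Set.range (𝓡∂ n)) (boundaryIncl y)
      (boundaryIncl a) = 0 := by
  have h := (differentiableWithinAt_comp_extend_symm he hf hy).hasFDerivWithinAt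
  have h1 : HasFDerivAt (fun z => f (boundaryParam e z))
      (fderivWithin ℝ (f ∘ (e.extend (𝓡∂ n)).symm) (Set.range (𝓡∂ n)) (boundaryIncl y)
        ∘L boundaryInclCLM n) y := by
    rw [← hasFDerivWithinAt_univ]
    exact HasFDerivWithinAt.comp y (f := boundaryInclCLM n) h
      (boundaryInclCLM n).hasFDerivAt.hasFDerivWithinAt fun z _ => boundaryIncl_mem_range z
  have h2 : (fun z => f (boundaryParam e z)) =ᶠ[𝓝 y] fun _ => 0 := by
    filter_upwards [isOpen_boundaryDomain.mem_nhds hy] with z hz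
    exact h0 _ (boundaryParam_mem_boundary he hz)
  exact DFunLike.congr_fun
    ((h1.congr_of_eventuallyEq h2.symm).unique (hasFDerivAt_const (0 : ℝ) y)) a

theorem mfderiv_eq_zero_of_normalCovector_eq_zero (hf : ContMDiff (𝓡∂ n) 𝓘(ℝ, ℝ) ∞ f)
    (h0 : ∀ q ∈ (𝓡∂ n).boundary M, f q = 0) (hp : p ∈ (𝓡∂ n).boundary M)
    (w : TangentSpace (𝓡∂ n) p) (hw : normalCovector p w = 0) :
    mfderiv (𝓡∂ n) 𝓘(ℝ, ℝ) f p w = 0 := by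
  have he : chartAt (EuclideanHalfSpace n) p ∈ IsManifold.maximalAtlas (𝓡∂ n) ∞ M :=
    IsManifold.chart_mem_maximalAtlas p
  have hb := boundaryProj_extend he (mem_chart_source (EuclideanHalfSpace n) p) hp
  have hw0 : (show EuclideanSpace ℝ (Fin n) from w) 0 = 0 := by
    rw [← normalCovector_apply p]
    exact hw
  have h := fderivWithin_boundaryIncl_eq_zero he hf h0 hb.1
    (boundaryProj n (show EuclideanSpace ℝ (Fin n) from w))
  rw [hb.2.1, boundaryIncl_boundaryProj hw0] at h
  exact (mfderiv_apply_eq_fderivWithin hf (show EuclideanSpace ℝ (Fin n) from w)).trans h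

/-- The differential of a function vanishing on the boundary is its normal derivative times the
dual of the unit normal. -/
theorem mfderiv_eq_normalDeriv_mul (hf : ContMDiff (𝓡∂ n) 𝓘(ℝ, ℝ) ∞ f)
    (h0 : ∀ q ∈ (𝓡∂ n).boundary M, f q = 0) (hp : p ∈ (𝓡∂ n).boundary M)
    (w : TangentSpace (𝓡∂ n) p) :
    (mfderiv (𝓡∂ n) 𝓘(ℝ, ℝ) f p w : ℝ)
      = normalDeriv g f p * g.inner p (inwardUnitNormal g p) w := by
  have hν := isInwardUnitNormal_inwardUnitNormal g p
  set ν := inwardUnitNormal g p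
  -- The coefficient for which `w - c • ν` is tangent to the boundary.
  set c : ℝ := normalCovector p w / normalCovector p ν with hc
  have hk : normalCovector p (w - c • ν) = 0 := by
    rw [map_sub, map_smul, smul_eq_mul, hc, div_mul_cancel₀ _ hν.inward.ne', sub_self]
  have h1 := mfderiv_eq_zero_of_normalCovector_eq_zero hf h0 hp _ hk
  have h2 := hν.orthogonal _ hk
  rw [map_sub, map_smul, hν.unit, smul_eq_mul, mul_one, sub_eq_zero] at h2
  rw [map_sub, map_smul, sub_eq_zero] at h1
  rw [h2, h1, mul_comm]
  rfl

/-- The point `p` is a minimum of `f`, and the inward normal lies in the tangent cone of the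
half-space. -/
theorem normalDeriv_nonneg (hf : ContMDiff (𝓡∂ n) 𝓘(ℝ, ℝ) ∞ f) (hf0 : ∀ q, 0 ≤ f q)
    (h0 : ∀ q ∈ (𝓡∂ n).boundary M, f q = 0) (hp : p ∈ (𝓡∂ n).boundary M) :
    0 ≤ normalDeriv g f p := by
  have he : chartAt (EuclideanHalfSpace n) p ∈ IsManifold.maximalAtlas (𝓡∂ n) ∞ M :=
    IsManifold.chart_mem_maximalAtlas p
  have hpe := mem_chart_source (EuclideanHalfSpace n) p
  have hν := isInwardUnitNormal_inwardUnitNormal g p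
  set e := chartAt (EuclideanHalfSpace n) p
  set v : EuclideanSpace ℝ (Fin n) := inwardUnitNormal g p with hv
  have hv0 : 0 < v 0 := by
    rw [← normalCovector_apply p]
    exact hν.inward
  set x := e.extend (𝓡∂ n) p with hx
  have hxT : x ∈ (e.extend (𝓡∂ n)).target :=
    (e.extend (𝓡∂ n)).map_source (by rwa [e.extend_source])
  have hmin : IsLocalMinOn (f ∘ (e.extend (𝓡∂ n)).symm) (Set.range (𝓡∂ n)) x := by
    filter_upwards with z
    simp only [Function.comp, hx, e.extend_left_inv hpe, h0 p hp]
    exact hf0 _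
  have hxr : x ∈ Set.range (𝓡∂ n) := e.extend_target_subset_range (I := 𝓡∂ n) hxT
  have hcone : v ∈ posTangentConeAt (Set.range (𝓡∂ n)) x := by
    refine mem_posTangentConeAt_of_segment_subset ((𝓡∂ n).convex_range.segment_subset hxr ?_)
    rw [range_modelWithCornersEuclideanHalfSpace]
    have : 0 ≤ x 0 := extend_zero_nonneg p
    change 0 ≤ x 0 + v 0
    linarith
  have h := hmin.hasFDerivWithinAt_nonneg
    (differentiableWithinAt_comp_extend_symm he hf hxT).hasFDerivWithinAt hcone
  exact h.trans_eq (mfderiv_apply_eq_fderivWithin hf v).symm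

/-- The squared length of the differential of `f` in the coordinates of the chart `e`. -/
def chartGradSq (g : SmoothMetric n M) (e : OpenPartialHomeomorph M (EuclideanHalfSpace n))
    (f : M → ℝ) (x : EuclideanSpace ℝ (Fin n)) : ℝ :=
  ∑ i, ∑ j, (chartMetricCoeff g e x)⁻¹ i j *
    (pderivWithin (Set.range (𝓡∂ n)) i (f ∘ (e.extend (𝓡∂ n)).symm) x *
      pderivWithin (Set.range (𝓡∂ n)) j (f ∘ (e.extend (𝓡∂ n)).symm) x)

theorem continuousOn_chartGradSq (he : e ∈ IsManifold.maximalAtlas (𝓡∂ n) ∞ M)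
    (hf : ContMDiff (𝓡∂ n) 𝓘(ℝ, ℝ) ∞ f) :
    ContinuousOn (chartGradSq g e f) (e.extend (𝓡∂ n)).target := by
  have h1 : ∀ i, ContinuousOn (pderivWithin (Set.range (𝓡∂ n)) i (f ∘ (e.extend (𝓡∂ n)).symm))
      (e.extend (𝓡∂ n)).target := fun i => by
    have h := ((contDiffOn_comp_extend_symm he hf).continuousOn_fderivWithin
      uniqueDiffOn_extend_target (by simp)).clm_apply
        (continuousOn_const (c := EuclideanSpace.single i (1 : ℝ)))
    refine h.congr fun x hx => ?_
    rw [pderivWithin, ← fderivWithin_congr_set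
      (nhdsWithin_eq_iff_eventuallyEq.1 (nhdsWithin_extend_target hx))]
  refine continuousOn_finsetSum _ fun i _ => continuousOn_finsetSum _ fun j _ => ?_
  exact (ContDiffOn.matrix_inv (contDiffOn_chartMetricCoeff g he)
    (fun x hx => (chartMetricCoeff_posDef g he hx).det_pos.ne') i j).continuousOn.mul
    ((h1 i).mul (h1 j))

/-- At the boundary `df = s g(ν, ·)` with `s` the normal derivative, and `ν` has unit length, so
`|df|² = s²`. -/
theorem chartGradSq_eq_sq_normalDeriv (he : e ∈ IsManifold.maximalAtlas (𝓡∂ n) ∞ M)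
    (hf : ContMDiff (𝓡∂ n) 𝓘(ℝ, ℝ) ∞ f) (h0 : ∀ q ∈ (𝓡∂ n).boundary M, f q = 0)
    {x : EuclideanSpace ℝ (Fin n)} (hx : x ∈ (e.extend (𝓡∂ n)).target)
    (hp : (e.extend (𝓡∂ n)).symm x ∈ (𝓡∂ n).boundary M) :
    chartGradSq g e f x = normalDeriv g f ((e.extend (𝓡∂ n)).symm x) ^ 2 := by
  have hν := isInwardUnitNormal_inwardUnitNormal g ((e.extend (𝓡∂ n)).symm x)
  set s := normalDeriv g f ((e.extend (𝓡∂ n)).symm x) with hs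
  set G := chartMetricCoeff g e x with hG
  have hGpos := chartMetricCoeff_posDef g he hx
  have hu : UniqueDiffWithinAt ℝ (Set.range (𝓡∂ n)) x :=
    (𝓡∂ n).uniqueDiffOn x (e.extend_target_subset_range (I := 𝓡∂ n) hx)
  obtain ⟨a, ha⟩ := (chartFrame_bijective he hx).2 (inwardUnitNormal g ((e.extend (𝓡∂ n)).symm x))
  have hD : ∀ j, pderivWithin (Set.range (𝓡∂ n)) j (f ∘ (e.extend (𝓡∂ n)).symm) x
      = s * ∑ i, a i * G i j := fun j => by
    have h1 := mfderiv_comp_mfderivWithin x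
      (hf.mdifferentiableAt (by simp : (∞ : WithTop ℕ∞) ≠ 0))
      (mdifferentiableWithinAt_extend_symm he hx) hu.uniqueMDiffWithinAt
    rw [mfderivWithin_eq_fderivWithin] at h1
    have h2 : pderivWithin (Set.range (𝓡∂ n)) j (f ∘ (e.extend (𝓡∂ n)).symm) x
        = mfderiv (𝓡∂ n) 𝓘(ℝ, ℝ) f ((e.extend (𝓡∂ n)).symm x)
          (chartFrame e x (EuclideanSpace.single j 1)) :=
      DFunLike.congr_fun h1 (EuclideanSpace.single j (1 : ℝ))
    rw [h2, mfderiv_eq_normalDeriv_mul (g := g) hf h0 hp, ← ha, inner_chartFrame]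
    congr 1
    refine Finset.sum_congr rfl fun i _ => ?_
    simp [hG]
  have h1 : ∑ i, ∑ j, a i * G i j * a j = 1 := by
    rw [← inner_chartFrame, ha]
    exact hν.unit
  have hGinv : G * G⁻¹ = 1 := Matrix.mul_nonsing_inv _ (isUnit_iff_ne_zero.2 hGpos.det_pos.ne')
  have h2 : ∀ j, ∑ i, (∑ k, a k * G k i) * G⁻¹ i j = a j := fun j => by
    calc ∑ i, (∑ k, a k * G k i) * G⁻¹ i j = ∑ k, a k * (G * G⁻¹) k j := by
          simp only [Matrix.mul_apply, Finset.mul_sum, Finset.sum_mul]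
          rw [Finset.sum_comm]
          exact Finset.sum_congr rfl fun k _ => Finset.sum_congr rfl fun i _ => by ring
      _ = a j := by
          rw [hGinv]
          simp [Matrix.one_apply]
  calc chartGradSq g e f x
      = ∑ j, s ^ 2 * ((∑ i, (∑ k, a k * G k i) * G⁻¹ i j) * ∑ k, a k * G k j) := by
        simp only [chartGradSq, hD]
        rw [Finset.sum_comm]
        refine Finset.sum_congr rfl fun j _ => ?_
        conv_rhs => rw [Finset.sum_mul, Finset.mul_sum]
        exact Finset.sum_congr rfl fun i _ => by ring
    _ = s ^ 2 * ∑ i, ∑ j, a i * G i j * a j := by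
        simp only [h2]
        rw [← Finset.mul_sum, Finset.sum_comm]
        congr 1
        refine Finset.sum_congr rfl fun j _ => ?_
        rw [Finset.mul_sum]
        exact Finset.sum_congr rfl fun k _ => by ring
    _ = s ^ 2 := by rw [h1, mul_one]

/-- The normal is chosen point by point, so its continuity is not directly available. The
nonnegative normal derivative equals `|df|`, which is continuous in every chart. -/
theorem continuousOn_normalDeriv (hf : ContMDiff (𝓡∂ n) 𝓘(ℝ, ℝ) ∞ f) (hf0 : ∀ q, 0 ≤ f q)
    (h0 : ∀ q ∈ (𝓡∂ n).boundary M, f q = 0) :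
    ContinuousOn (normalDeriv g f) ((𝓡∂ n).boundary M) := by
  intro p hp
  have he : chartAt (EuclideanHalfSpace n) p ∈ IsManifold.maximalAtlas (𝓡∂ n) ∞ M :=
    IsManifold.chart_mem_maximalAtlas p
  have hpe := mem_chart_source (EuclideanHalfSpace n) p
  set e := chartAt (EuclideanHalfSpace n) p
  have hc : ContinuousOn (fun q => √(chartGradSq g e f (e.extend (𝓡∂ n) q))) e.source := by
    refine Real.continuous_sqrt.comp_continuousOn ((continuousOn_chartGradSq he hf).comp
      (e.extend_source (I := 𝓡∂ n) ▸ e.continuousOn_extend (I := 𝓡∂ n)) fun q hq => ?_)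
    exact (e.extend (𝓡∂ n)).map_source (by rwa [e.extend_source])
  have heq : ∀ q ∈ (𝓡∂ n).boundary M, q ∈ e.source →
      normalDeriv g f q = √(chartGradSq g e f (e.extend (𝓡∂ n) q)) := fun q hq hqe => by
    have hinv : (e.extend (𝓡∂ n)).symm (e.extend (𝓡∂ n) q) = q := e.extend_left_inv hqe
    rw [chartGradSq_eq_sq_normalDeriv he hf h0
      ((e.extend (𝓡∂ n)).map_source (by rwa [e.extend_source])) (by rwa [hinv]), hinv,
      Real.sqrt_sq (normalDeriv_nonneg hf hf0 h0 hq)]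
  refine ((hc.continuousAt (e.open_source.mem_nhds hpe)).continuousWithinAt).congr_of_eventuallyEq
    ?_ (heq p hp hpe)
  filter_upwards [self_mem_nhdsWithin, nhdsWithin_le_nhds (e.open_source.mem_nhds hpe)]
    with q hq hqe using heq q hq hqe

theorem continuousOn_fluxDensity (hn : 3 ≤ n) (hf : ContMDiff (𝓡∂ n) 𝓘(ℝ, ℝ) ∞ f)
    (hf0 : ∀ q, 0 ≤ f q) (h0 : ∀ q ∈ (𝓡∂ n).boundary M, f q = 0) :
    ContinuousOn (fluxDensity g f) ((𝓡∂ n).boundary M) := by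
  have : (3 : ℝ) ≤ n := mod_cast hn
  exact (continuousOn_normalDeriv hf hf0 h0).rpow_const fun _ _ => Or.inr
    (div_nonneg (by linarith) (by linarith))

/-- The rescaled normal satisfies the three defining conditions, which determine it. -/
theorem inwardUnitNormal_conformal {c : ℝ} (hc : 0 < c)
    (h : ∀ v w : TangentSpace (𝓡∂ n) p, g'.inner p v w = c * g.inner p v w) :
    inwardUnitNormal g' p = (√c)⁻¹ • inwardUnitNormal g p := by
  have hν := isInwardUnitNormal_inwardUnitNormal g p
  have hs : 0 < √c := Real.sqrt_pos.2 hc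
  refine (isInwardUnitNormal_inwardUnitNormal g' p).unique ⟨?_, fun w hw => ?_, ?_⟩
  · simp only [h, map_smul, FunLike.coe_smul, Pi.smul_apply, smul_eq_mul, hν.unit]
    field_simp
    rw [Real.sq_sqrt hc.le]
  · simp only [h, map_smul, FunLike.coe_smul, Pi.smul_apply, smul_eq_mul, hν.orthogonal w hw,
      mul_zero]
  · rw [map_smul, smul_eq_mul]
    exact mul_pos (inv_pos.2 hs) hν.inward

theorem normalDeriv_mul_of_eq_zero {u : M → ℝ} (hu : ContMDiff (𝓡∂ n) 𝓘(ℝ, ℝ) ∞ u)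
    (hf : ContMDiff (𝓡∂ n) 𝓘(ℝ, ℝ) ∞ f) (hp : f p = 0) :
    normalDeriv g (fun q => u q * f q) p = u p * normalDeriv g f p := by
  have h := (hu.mdifferentiableAt (x := p) (by simp)).hasMFDerivAt.mul
    (hf.mdifferentiableAt (x := p) (by simp)).hasMFDerivAt
  have h' : normalDeriv g (fun q => u q * f q) p
      = u p * normalDeriv g f p + f p * normalDeriv g u p :=
    DFunLike.congr_fun h.mfderiv (inwardUnitNormal g p)
  rw [h', hp, zero_mul, add_zero]

theorem normalDeriv_conformal {c : ℝ} (hc : 0 < c)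
    (h : ∀ v w : TangentSpace (𝓡∂ n) p, g'.inner p v w = c * g.inner p v w) :
    normalDeriv g' f p = (√c)⁻¹ * normalDeriv g f p := by
  rw [normalDeriv, inwardUnitNormal_conformal hc h, map_smul]
  rfl

end NormalDerivative

/-! ### Cancellation of the powers of the conformal factor -/

section Invariance

variable {n : ℕ} [NeZero n] {M : Type*} [TopologicalSpace M]
  [ChartedSpace (EuclideanHalfSpace n) M] [IsManifold (𝓡∂ n) ∞ M]
  {g g' : SmoothMetric n M}

/-- The exponents of `u` satisfy `2(n-1)/(n-2) - (2/(n-2)) · 2(n-1)/n = 2(n-1)/n`. -/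
theorem rpow_flux_mul_density (hn : 3 ≤ n) {u s : ℝ} (hu : 0 < u) (hs : 0 ≤ s) :
    √((u ^ (4 / ((n : ℝ) - 2))) ^ (n - 1)) *
        ((√(u ^ (4 / ((n : ℝ) - 2))))⁻¹ * s) ^ (2 * ((n : ℝ) - 1) / n)
      = (u * s) ^ (2 * ((n : ℝ) - 1) / n) := by
  have hn3 : (3 : ℝ) ≤ n := mod_cast hn
  have hn2 : (n : ℝ) - 2 ≠ 0 := by linarith
  have hn0 : (n : ℝ) ≠ 0 := by linarith
  rw [Real.mul_rpow (by positivity) hs, Real.mul_rpow hu.le hs, ← mul_assoc]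
  congr 1
  rw [Real.sqrt_eq_rpow, Real.sqrt_eq_rpow, ← Real.rpow_natCast, ← Real.rpow_mul hu.le,
    ← Real.rpow_mul hu.le, ← Real.rpow_mul hu.le, ← Real.rpow_neg hu.le, ← Real.rpow_mul hu.le,
    ← Real.rpow_add hu, Nat.cast_sub (by omega)]
  congr 1
  push_cast
  field_simp
  ring

/-- The integral is the total mass of the flux measure, so equal measures give equal integrals. -/
theorem setIntegral_boundary_fluxDensity [MeasurableSpace M] [BorelSpace M] {f : M → ℝ}
    (hc : ContinuousOn (fluxDensity g f) ((𝓡∂ n).boundary M))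
    (hf : ∀ p ∈ (𝓡∂ n).boundary M, 0 ≤ normalDeriv g f p) :
    ∫ p in (𝓡∂ n).boundary M, fluxDensity g f p ∂(boundaryMeasure g) =
      ((boundaryMeasure g).withDensity
        (fun p => ENNReal.ofReal (fluxDensity g f p)) Set.univ).toReal := by
  have hbm : MeasurableSet ((𝓡∂ n).boundary M) :=
    (ModelWithCorners.isClosed_boundary (n := ∞) (by simp)).measurableSet
  have h0 : 0 ≤ᵐ[(boundaryMeasure g).restrict ((𝓡∂ n).boundary M)] fluxDensity g f :=
    (ae_restrict_iff' hbm).2 (Eventually.of_forall fun p hp => Real.rpow_nonneg (hf p hp) _)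
  rw [integral_eq_lintegral_of_nonneg_ae h0 (hc.aemeasurable hbm).aestronglyMeasurable,
    boundaryMeasure_restrict_boundary, withDensity_apply _ MeasurableSet.univ,
    Measure.restrict_univ]

end Invariance

end

/-! ### The invariance theorem -/

theorem lemma3p2 (n : ℕ) [NeZero n] (hn : 3 ≤ n)
    {M : Type*} [TopologicalSpace M] [T2Space M] [SecondCountableTopology M] [ConnectedSpace M]
    [ChartedSpace (EuclideanHalfSpace n) M] [IsManifold (𝓡∂ n) ∞ M]
    [MeasurableSpace M] [BorelSpace M]
    (hcompact : IsCompact ((𝓡∂ n).boundary M)) (hnonempty : ((𝓡∂ n).boundary M).Nonempty)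
    (g : SmoothMetric n M) (hg : IsAsymptoticallyFlat g)
    (g' : SmoothMetric n M) (hg' : g' ∈ harmonicConformalClass g)
    (φ φ' : M → ℝ) (hφ : IsBoundaryPotential g φ) (hφ' : IsBoundaryPotential g' φ') :
    (IntegrableOn (fluxDensity g φ) ((𝓡∂ n).boundary M) (boundaryMeasure g) ∧
      IntegrableOn (fluxDensity g' φ') ((𝓡∂ n).boundary M) (boundaryMeasure g')) ∧
    (boundaryMeasure g').withDensity (fun p => ENNReal.ofReal (fluxDensity g' φ' p)) =
      (boundaryMeasure g).withDensity (fun p => ENNReal.ofReal (fluxDensity g φ p)) ∧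
    ∫ p in (𝓡∂ n).boundary M, fluxDensity g' φ' p ∂(boundaryMeasure g') =
      ∫ p in (𝓡∂ n).boundary M, fluxDensity g φ p ∂(boundaryMeasure g) ∧
    invariantI2 g' φ' = invariantI2 g φ := by
  obtain ⟨u, hu, huh, hul, hconf⟩ := hg'
  have hkpos : ∀ p, 0 < u p ^ (4 / ((n : ℝ) - 2)) := fun p => Real.rpow_pos_of_pos (hu p) _
  have hkc : Continuous fun p => u p ^ (4 / ((n : ℝ) - 2)) :=
    huh.1.continuous.rpow_const fun p => Or.inl (hu p).ne'
  have hmul := hφ.eq_mul hnonempty hn hu hconf huh hul hφ'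
  have hF := continuousOn_fluxDensity (g := g) hn hφ.harmonic.1 (hφ.nonneg hnonempty) hφ.eq_zero
  have hF' := continuousOn_fluxDensity (g := g') hn hφ'.harmonic.1 (hφ'.nonneg hnonempty)
    hφ'.eq_zero
  have hpos : ∀ p ∈ (𝓡∂ n).boundary M, 0 ≤ normalDeriv g φ p := fun p =>
    normalDeriv_nonneg hφ.harmonic.1 (hφ.nonneg hnonempty) hφ.eq_zero
  have hpos' : ∀ p ∈ (𝓡∂ n).boundary M, 0 ≤ normalDeriv g' φ' p := fun p =>
    normalDeriv_nonneg hφ'.harmonic.1 (hφ'.nonneg hnonempty) hφ'.eq_zero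
  have hbm : MeasurableSet ((𝓡∂ n).boundary M) := hcompact.isClosed.measurableSet
  have hfin := isFiniteMeasure_boundaryMeasure hcompact g
  have hfin' := isFiniteMeasure_boundaryMeasure hcompact g'
  have hmeasure : boundaryMeasure g' = (boundaryMeasure g).withDensity
      fun p => ENNReal.ofReal √((u p ^ (4 / ((n : ℝ) - 2))) ^ (n - 1)) :=
    boundaryMeasure_conformal hkpos hkc hconf
  have hflux : ∀ p ∈ (𝓡∂ n).boundary M,
      √((u p ^ (4 / ((n : ℝ) - 2))) ^ (n - 1)) * fluxDensity g' φ' p = fluxDensity g φ p :=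
    fun p hp => by
      have h1 : normalDeriv g φ p = u p * normalDeriv g φ' p := by
        rw [show φ = fun q => u q * φ' q from funext hmul]
        exact normalDeriv_mul_of_eq_zero huh.1 hφ'.harmonic.1 (hφ'.eq_zero p hp)
      have h2 : 0 ≤ normalDeriv g φ' p :=
        normalDeriv_nonneg hφ'.harmonic.1 (hφ'.nonneg hnonempty) hφ'.eq_zero hp
      rw [fluxDensity, fluxDensity, normalDeriv_conformal (hkpos p) (hconf p),
        rpow_flux_mul_density hn (hu p) h2, h1]
  have hwd : (boundaryMeasure g').withDensity (fun p => ENNReal.ofReal (fluxDensity g' φ' p)) =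
      (boundaryMeasure g).withDensity (fun p => ENNReal.ofReal (fluxDensity g φ p)) := by
    -- The flux density is controlled only on the boundary, which carries the measure; almost
    -- everywhere measurability is all that is needed.
    have hae : AEMeasurable (fluxDensity g' φ') (boundaryMeasure g) := by
      rw [← boundaryMeasure_restrict_boundary]
      exact hF'.aemeasurable hbm
    have hρ : Measurable fun p => ENNReal.ofReal √((u p ^ (4 / ((n : ℝ) - 2))) ^ (n - 1)) :=
      (hkc.pow _).sqrt.measurable.ennreal_ofReal
    rw [hmeasure, ← withDensity_mul₀ hρ.aemeasurable hae.ennreal_ofReal]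
    refine withDensity_congr_ae ?_
    have hmem : ∀ᵐ p ∂boundaryMeasure g, p ∈ (𝓡∂ n).boundary M := boundaryMeasure_compl_boundary
    filter_upwards [hmem] with p hp
    rw [Pi.mul_apply, ← ENNReal.ofReal_mul (Real.sqrt_nonneg _), hflux p hp]
  have hint : ∫ p in (𝓡∂ n).boundary M, fluxDensity g' φ' p ∂(boundaryMeasure g') =
      ∫ p in (𝓡∂ n).boundary M, fluxDensity g φ p ∂(boundaryMeasure g) := by
    rw [setIntegral_boundary_fluxDensity hF' hpos', setIntegral_boundary_fluxDensity hF hpos, hwd]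
  refine ⟨⟨hF.integrableOn_compact hcompact, hF'.integrableOn_compact hcompact⟩, hwd, hint, ?_⟩
  rw [invariantI2, invariantI2, hint]
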